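/- **Setting.** Let $N\ge K\ge 1$ be integers and $\mathbb T_m=\mathbb Z/m\mathbb Z$. Let $\Sigma_{N,K}$ be the set of $\eta\in\{0,1\}^{\mathbb T_N}$ with $\sum_x\eta_x=K$, and $\Gamma_K=\{n\in\mathbb Z: n\le 1\}^{\mathbb T_K}$. For a discrete space $S$, let $D([0,\infty),S)$ be the set of right-continuous $S$-valued trajectories with left limits, with the σ-algebra generated by the evaluation maps. *FEP.* The facilitated exclusion process on $\Sigma_{N,K}$ has generator $$\mathscr L^{\rm fep}f(\eta)=\sum_{x\in\mathbb T_N}c_{x,x+1}(\eta)\{f(\eta^{x,x+1})-f(\eta)\},\qquad c_{x,x+1}(\eta)=\eta_{x-1}\eta_x(1-\eta_{x+1})+(1-\eta_x)\eta_{x+1}\eta_{x+2},$$ where $\eta^{x,x+1}$ is $\eta$ with the contents of $x$ and $x+1$ exchanged. Its frozen set is $\mathcal F^{\rm fep}=\{\eta:\eta_x\eta_{x+1}=0\ \forall x\}$, its ergodic set is $\mathcal E^{\rm fep}=\{\eta:(1-\eta_x)(1-\eta_{x+1})=0\ \forall x\}$, and its transient set $\mathcal T^{\rm fep}$ consists of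 the $\eta$ that are not frozen with $K\le N/2$, or not ergodic with $K\ge N/2$. *SWT.* The SSEP with traps on $\Gamma_K$ has generator $$\mathscr L^{\rm swt}f(\xi)=\sum_{k\in\mathbb T_K}\sum_{z=\pm1}\mathbf 1_{\{\xi_k=1,\ \xi_{k+z}\le 0\}}\{f(\xi^{k,k+z})-f(\xi)\},$$ where $\xi^{k,k+z}$ is $\xi$ with the value at $k$ replaced by $0$ and the value at $k+z$ replaced by $\xi_{k+z}+1$. Its frozen set is $\mathcal F^{\rm swt}=\{\xi:\xi_k\le0\ \forall k\}$, its ergodic set is $\mathcal E^{\rm swt}=\{\xi:\xi_k\ge0\ \forall k\}$, and its transient set is $$\mathcal T^{\rm swt}=\Big\{\xi:\ -\sum_k\min(\xi_k,0)>0 \text{ and } \sum_k\mathbf 1_{\{\xi_k=1\}}>0\Big\}.$$ Write $\mathbb P_\eta$ and $\mathbf P_\xi$ for the laws on trajectories of the FEP and of the SWT started from $\eta$ and from $\xi$. *Trajectories.* A trajectory in $D([0,\infty),\Sigma_{N,K})$ is an *exclusion trajectory* if each of its jumps moves one particle to a neighbouring empty site. It is a *FEP trajectory* if each of its jumps is of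 the form $\eta\to\eta^{x,x+1}$ with $c_{x,x+1}(\eta)>0$. *Tagged positions.* Unroll the particles of a configuration on $\mathbb Z$ and list their positions as $\dots<X_0<X_1<X_2<\dots$, with $X_{k+K}=X_k+N$ and with $X_1$ the first particle at or to the right of the origin ($X_0<0\le X_1$). Along an exclusion trajectory, particles are numbered in this way at time $0$ and then followed, each jump moving one label (modulo $K$) by one unit. This gives $X_k(t)$. **Theorem 2.3.** There are a map $\Pi:\Sigma_{N,K}\to\Gamma_K$ and a measurable map $\Pi^\star:D([0,\infty),\Sigma_{N,K})\to D([0,\infty),\Gamma_K)$ such that: 1. $\Pi(\eta)_k=2+X_k-X_{k+1}$ for every $\eta\in\Sigma_{N,K}$, and $\Pi^\star[\eta](0)=\Pi(\eta(0))$ for every trajectory. Every exclusion trajectory $\eta(\cdot)$ has tagged positions, and for any such positions, $\Pi^\star[\eta](t)_k=2+X_k(t)-X_{k+1}(t)$ for all $t\ge0$ and all $k$. 2. If $\eta(\cdot)\sim\mathbb P_\eta$, then almost surely $\eta(\cdot)$ is a FEP trajectory, and $\Pi^\star[\eta]\sim\mathbf P_{\Pi(\eta)}$. 3. Conversely, let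 $\eta(\cdot)$ be a random trajectory with $\eta(0)=\eta$ a.s. such that $\Pi^\star[\eta]\sim\mathbf P_{\Pi(\eta)}$. Then $\eta(\cdot)\sim\mathbb P_\eta$, provided that either $K\ge3$ and $\eta(\cdot)$ is a.s. an exclusion trajectory, or ($K\neq2$ or $N=2$) and $\eta(\cdot)$ is a.s. a FEP trajectory. 4. For every trajectory $\eta(\cdot)\in D([0,\infty),\Sigma_{N,K})$ and every $t\ge0$, $$\eta(t)\in\mathcal E^{\rm fep}\iff\Pi^\star[\eta](t)\in\mathcal E^{\rm swt},\qquad \eta(t)\in\mathcal F^{\rm fep}\iff\Pi^\star[\eta](t)\in\mathcal F^{\rm swt},\qquad \eta(t)\in\mathcal T^{\rm fep}\iff\Pi^\star[\eta](t)\in\mathcal T^{\rm swt}.$$ -/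

import Mathlib

open MeasureTheory Filter Topology
open scoped NNReal

namespace FepSwt

/-! ### Trajectories in a discrete state space and laws driven by a generator -/

/-- Right-continuous trajectories with left limits, with values in a discrete space `S`. -/
structure CadlagPath (S : Type*) where
  toFun : ℝ≥0 → S
  right_cont : ∀ t, ∀ᶠ s in 𝓝[>] t, toFun s = toFun t
  left_lim : ∀ t, ∃ a, ∀ᶠ s in 𝓝[<] t, toFun s = a

instance (S : Type*) : CoeFun (CadlagPath S) (fun _ => ℝ≥0 → S) := ⟨CadlagPath.toFun⟩

/-- The σ-algebra generated by the evaluation maps. -/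
instance (S : Type*) : MeasurableSpace (CadlagPath S) :=
  ⨆ t : ℝ≥0, MeasurableSpace.comap (fun ω : CadlagPath S => ω t) ⊤

/-- The canonical filtration: at time `t`, it is generated by the evaluations at times `s ≤ t`. -/
def canonicalFiltration (S : Type*) :
    Filtration ℝ≥0 (inferInstance : MeasurableSpace (CadlagPath S)) where
  seq t := ⨆ s : ℝ≥0, ⨆ _ : s ≤ t, MeasurableSpace.comap (fun ω : CadlagPath S => ω s) ⊤
  mono' _ _ h := iSup_mono fun _ => iSup_mono' fun hs => ⟨hs.trans h, le_rfl⟩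
  le' _ := iSup_le fun s => iSup_le fun _ =>
    le_iSup (fun s : ℝ≥0 => MeasurableSpace.comap (fun ω : CadlagPath S => ω s) ⊤) s

/-- `μ` is the law of the continuous-time Markov process on `S` driven by the (bounded) generator
`L` and started from `x₀`, in the sense of the martingale problem: for every bounded `f`,
`f(ω(t)) - f(ω(0)) - ∫₀ᵗ L f(ω(s)) ds` is a martingale in the canonical filtration. -/
structure IsMarkovLaw {S : Type*} (L : (S → ℝ) → S → ℝ) (x₀ : S)
    (μ : Measure (CadlagPath S)) : Prop where
  isProb : IsProbabilityMeasure μ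
  initial : ∀ᵐ ω ∂μ, ω 0 = x₀
  martingale : ∀ f : S → ℝ, (∃ C : ℝ, ∀ x, |f x| ≤ C) →
    Martingale (fun (t : ℝ≥0) (ω : CadlagPath S) =>
      f (ω t) - f (ω 0) - ∫ s in (0 : ℝ)..t, L f (ω s.toNNReal)) (canonicalFiltration S) μ

/-! ### The SSEP with traps (SWT) on the ring `ZMod K` -/

/-- The state space `Γ_K` of the SWT. -/
def Gam (K : ℕ) : Type := {ξ : ZMod K → ℤ // ∀ k, ξ k ≤ 1}

/-- The configuration `ξ^{k,l}`: the particle at `k` jumps to the empty site or trap `l`. -/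
def Gam.jump {K : ℕ} (ξ : Gam K) (k l : ZMod K) (hl : ξ.1 l ≤ 0) : Gam K :=
  ⟨fun k' => if k' = k then 0 else if k' = l then ξ.1 l + 1 else ξ.1 k', fun k' => by
    have := ξ.2 k'
    dsimp only
    split_ifs <;> omega⟩

/-- The generator of the SWT. The sum over `z` is over the integers `1, -1`, so that the two jumps
are counted separately also when `K = 2`. -/
noncomputable def swtGen (K : ℕ) [NeZero K] (f : Gam K → ℝ) (ξ : Gam K) : ℝ :=
  ∑ k : ZMod K, ∑ z ∈ ({1, -1} : Finset ℤ),
    if h : ξ.1 k = 1 ∧ ξ.1 (k + (z : ZMod K)) ≤ 0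
      then f (ξ.jump k (k + (z : ZMod K)) h.2) - f ξ else 0

/-- Frozen SWT configurations: no particle. -/
def swtFrozen (K : ℕ) : Set (Gam K) := {ξ | ∀ k, ξ.1 k ≤ 0}

/-- Ergodic SWT configurations: no trap of positive depth. -/
def swtErgodic (K : ℕ) : Set (Gam K) := {ξ | ∀ k, 0 ≤ ξ.1 k}

/-- The total trap depth `|ξ⁻|`. -/
def trapDepth {K : ℕ} [NeZero K] (ξ : Gam K) : ℤ := -∑ k : ZMod K, min (ξ.1 k) 0

/-- The number of particles `|ξ⁺|`. -/
def swtParticles {K : ℕ} [NeZero K] (ξ : Gam K) : ℤ :=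
  ∑ k : ZMod K, if ξ.1 k = 1 then 1 else 0

/-- Transient SWT configurations. -/
def swtTransient (K : ℕ) [NeZero K] : Set (Gam K) :=
  {ξ | 0 < trapDepth ξ ∧ 0 < swtParticles ξ}

/-! ### The facilitated exclusion process (FEP) on the ring `ZMod N` -/

/-- The state space `Σ_{N,K}`: exclusion configurations on `ZMod N` with `K` particles. -/
def Conf (N K : ℕ) [NeZero N] : Type :=
  {η : ZMod N → Bool // (Finset.univ.filter fun x => η x = true).card = K}

/-- `η_x` as a real number in `{0, 1}`. -/
def Conf.occ {N K : ℕ} [NeZero N] (η : Conf N K) (x : ZMod N) : ℝ := if η.1 x = true then 1 else 0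

/-- `η^{x,x+1}`: the contents of the sites `x` and `x + 1` are exchanged. -/
def Conf.exch {N K : ℕ} [NeZero N] (η : Conf N K) (x : ZMod N) : Conf N K :=
  ⟨fun y => η.1 (Equiv.swap x (x + 1) y), by
    refine Eq.trans ?_ η.2
    exact Finset.card_equiv (Equiv.swap x (x + 1)) (by simp)⟩

/-- The jump rate `c_{x,x+1}(η)`. -/
def fepRate {N K : ℕ} [NeZero N] (η : Conf N K) (x : ZMod N) : ℝ :=
  η.occ (x - 1) * η.occ x * (1 - η.occ (x + 1))
    + (1 - η.occ x) * η.occ (x + 1) * η.occ (x + 2)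

/-- The generator of the FEP, on functions of configurations with `K` particles (the number of
particles is conserved). -/
noncomputable def fepGen (N K : ℕ) [NeZero N] (f : Conf N K → ℝ) (η : Conf N K) : ℝ :=
  ∑ x : ZMod N, fepRate η x * (f (η.exch x) - f η)

/-- Frozen FEP configurations: no two neighbouring particles. -/
def fepFrozen (N K : ℕ) [NeZero N] : Set (Conf N K) := {η | ∀ x, η.occ x * η.occ (x + 1) = 0}

/-- Ergodic FEP configurations: no two neighbouring empty sites. -/
def fepErgodic (N K : ℕ) [NeZero N] : Set (Conf N K) :=
  {η | ∀ x, (1 - η.occ x) * (1 - η.occ (x + 1)) = 0}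

/-- Transient FEP configurations: subcritical and not frozen, or supercritical and not ergodic. -/
def fepTransient (N K : ℕ) [NeZero N] : Set (Conf N K) :=
  {η | (η ∉ fepFrozen N K ∧ (K : ℝ) ≤ N / 2) ∨ (η ∉ fepErgodic N K ∧ (N : ℝ) / 2 ≤ K)}

/-- Exclusion trajectories: at each jump time, one particle moves to a neighbouring empty site. -/
def IsExclusionPath {N K : ℕ} [NeZero N] (ω : CadlagPath (Conf N K)) : Prop :=
  ∀ t, 0 < t → ∀ a, (∀ᶠ s in 𝓝[<] t, ω s = a) → ω t = a ∨ ∃ x, ω t = a.exch x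

/-- Trajectories all of whose jumps are allowed by the FEP. -/
def IsFepPath {N K : ℕ} [NeZero N] (ω : CadlagPath (Conf N K)) : Prop :=
  ∀ t, 0 < t → ∀ a, (∀ᶠ s in 𝓝[<] t, ω s = a) →
    ω t = a ∨ ∃ x, 0 < fepRate a x ∧ ω t = a.exch x

/-! ### Tagged particles -/

/-- `X` lists, in increasing order, the positions of the particles of `η` unrolled on `ℤ`, with
the convention `X_{k+K} = X_k + N`. -/
structure IsEnum {N K : ℕ} [NeZero N] (η : Conf N K) (X : ℤ → ℤ) : Prop where
  mono : StrictMono X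
  periodic : ∀ k, X (k + K) = X k + N
  mem_iff : ∀ x : ℤ, η.1 (x : ZMod N) = true ↔ ∃ k, X k = x

/-- Particle number `1` is the first particle at or to the right of the origin. -/
def IsFirst (X : ℤ → ℤ) : Prop := X 0 < 0 ∧ 0 ≤ X 1

/-- `X t k` is the position at time `t` of the tagged particle `k` along the trajectory `ω`:
at time `0` the particles are numbered from the first one at or to the right of the origin, and
afterwards the numbers follow the particles; at each jump time at most one particle
(a label modulo `K`) moves, by one unit. -/
structure IsTagging {N K : ℕ} [NeZero N] (ω : CadlagPath (Conf N K)) (X : ℝ≥0 → ℤ → ℤ) :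
    Prop where
  isEnum : ∀ t, IsEnum (ω t) (X t)
  initial : IsFirst (X 0)
  right_cont : ∀ t, ∀ᶠ s in 𝓝[>] t, X s = X t
  jump : ∀ t, 0 < t → ∃ Y : ℤ → ℤ, (∀ᶠ s in 𝓝[<] t, X s = Y) ∧
    (X t = Y ∨ ∃ j e : ℤ, (e = 1 ∨ e = -1) ∧
      ∀ k, X t k = if (K : ℤ) ∣ k - j then Y k + e else Y k)

end FepSwt

/-! A facilitated move needs a particle just behind the moving one and a hole just in front of it.
In the variables `ξ_k = 2 + X_k - X_{k+1}`, a particle behind means that the gap behind has value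
`1`, a hole in front means that the gap in front has value `≤ 0`, and moving label `j` by one unit
transfers one unit between `ξ_{j-1}` and `ξ_j`. Thus FEP moves are exactly SWT jumps, all at rate
one. `IsEnum.fepGen_eq_swtGen` states this for test functions on the two sides that need only match
along the moves, so that it serves in both directions.

The difficulty is that the gaps of tagged particles are not a function of the current configuration:
the numbering from the origin changes whenever a particle crosses the origin. The correction is a
sum over jump times of `labelShift`, an additive functional of the path. The probabilistic core is
therefore a statement about general processes: a function of a Markov process and of an additive
functional of its jumps solves a martingale problem as soon as the generators are intertwined
(`isMarkovLaw_map_extend`). It follows from `setIntegral_jumpSum`, proved by freezing the functional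
on the cells of a fine grid. Laws are given by martingale problems, so uniqueness of their solutions
is never used.

Labels are well defined by a counting invariant: over one period, relabelling by `m` changes the sum
of the positions by `m * N`, while one move changes it by `±1` (`IsEnum.moveLabel_unique`). For `K =
1` labels are irrelevant, the only gap being `2 - N`.

For the converse with `K ≥ 3`, a jump of the gaps reveals which particle moved and how
(`dipole_injective`). The position of label `0` is then an additive functional of the SWT path, and
with the gaps it recovers the configuration; the same general result applies to this inverse map.
For `K = 1` or `N ≤ 2` all FEP rates vanish and FEP trajectories are constant.

Frozen and ergodic configurations are read off the gaps for any numbering, and the transient ones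
are matched through `∑ ξ_k = 2K - N`. -/

namespace FepSwt

/-! ### Jump times and additive functionals of càdlàg paths in a discrete space -/

/-- Induction along the half line: a property which holds at `0`, propagates to the right of every
point and passes to limits from the left holds everywhere. -/
theorem nnreal_induction {P : ℝ≥0 → Prop} (h0 : P 0)
    (hr : ∀ t, P t → ∀ᶠ s in 𝓝[>] t, P s)
    (hl : ∀ t, 0 < t → (∀ s < t, P s) → P t) (t : ℝ≥0) : P t := by
  by_contra hcon
  set B : Set ℝ≥0 := {s | ¬ P s} with hB
  have hne : B.Nonempty := ⟨t, hcon⟩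
  have hbdd : BddBelow B := ⟨0, fun _ _ => zero_le⟩
  set m := sInf B with hm
  have hlt : ∀ s < m, P s := fun s hs => by
    by_contra h
    exact absurd (csInf_le hbdd (show s ∈ B from h)) (not_le.2 hs)
  have hPm : P m := by
    rcases eq_or_lt_of_le (zero_le (a := m)) with h | h
    · rw [← h]; exact h0
    · exact hl m h hlt
  obtain ⟨b, hb, hsub⟩ := (mem_nhdsGT_iff_exists_Ioo_subset' (lt_add_one m)).1 (hr m hPm)
  obtain ⟨s, hs, hsb⟩ := exists_lt_of_csInf_lt hne (show sInf B < b from hb)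
  have hms : m ≤ s := csInf_le hbdd hs
  rcases eq_or_lt_of_le hms with h | h
  · exact hs (h ▸ hPm)
  · exact hs (hsub ⟨h, hsb⟩)

namespace CadlagPath

variable {S A : Type*}

/-- The left limit of a path. -/
noncomputable def leftLim (ω : CadlagPath S) (t : ℝ≥0) : S := (ω.left_lim t).choose

theorem leftLim_spec (ω : CadlagPath S) (t : ℝ≥0) : ∀ᶠ s in 𝓝[<] t, ω s = ω.leftLim t :=
  (ω.left_lim t).choose_spec

/-- The jump times of a path. -/
def jumps (ω : CadlagPath S) : Set ℝ≥0 := {t | 0 < t ∧ ω t ≠ ω.leftLim t}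

theorem nhdsLT_neBot {t : ℝ≥0} (h : 0 < t) : (𝓝[<] t).NeBot := nhdsLT_neBot_of_exists_lt ⟨0, h⟩

theorem leftLim_eq (ω : CadlagPath S) {t : ℝ≥0} (ht : 0 < t) {a : S}
    (h : ∀ᶠ s in 𝓝[<] t, ω s = a) : ω.leftLim t = a := by
  have := nhdsLT_neBot ht
  obtain ⟨s, h1, h2⟩ := (h.and (ω.leftLim_spec t)).exists
  exact h2.symm.trans h1

theorem not_mem_jumps_of_eventually (ω : CadlagPath S) {t : ℝ≥0} {a : S}
    (h : ∀ᶠ s in 𝓝 t, ω s = a) : t ∉ ω.jumps := fun ht =>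
  ht.2 (h.self_of_nhds.trans (ω.leftLim_eq ht.1 (h.filter_mono nhdsWithin_le_nhds)).symm)

/-- In a discrete space the path is constant on a small interval on each side of `t`, so jump times
are isolated. -/
theorem eventually_not_mem_jumps (ω : CadlagPath S) (t : ℝ≥0) :
    ∀ᶠ s in 𝓝[≠] t, s ∉ ω.jumps := by
  rw [← Set.Iio_union_Ioi, nhdsWithin_union, eventually_sup]
  constructor
  · have h := eventually_eventually_nhdsWithin.2 (ω.leftLim_spec t)
    filter_upwards [h, self_mem_nhdsWithin] with s hs hst
    rw [IsOpen.nhdsWithin_eq isOpen_Iio hst] at hs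
    exact ω.not_mem_jumps_of_eventually hs
  · have h := eventually_eventually_nhdsWithin.2 (ω.right_cont t)
    filter_upwards [h, self_mem_nhdsWithin] with s hs hst
    rw [IsOpen.nhdsWithin_eq isOpen_Ioi hst] at hs
    exact ω.not_mem_jumps_of_eventually hs

/-- An infinite set of jump times in a compact interval would accumulate, against
`eventually_not_mem_jumps`. -/
theorem jumps_finite (ω : CadlagPath S) (T : ℝ≥0) : (ω.jumps ∩ Set.Iic T).Finite := by
  by_contra h
  have hinf : (ω.jumps ∩ Set.Iic T).Infinite := h
  have hsub : ω.jumps ∩ Set.Iic T ⊆ Set.Icc 0 T := fun x hx => ⟨zero_le, hx.2⟩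
  obtain ⟨x, -, hx⟩ := hinf.exists_accPt_of_subset_isCompact isCompact_Icc hsub
  rw [accPt_iff_frequently_nhdsNE] at hx
  exact hx ((ω.eventually_not_mem_jumps x).mono fun s hs hs' => hs hs'.1)

theorem eq_of_no_jumps (ω : CadlagPath S) {a b : ℝ≥0} (hab : a ≤ b)
    (h : ∀ s ∈ Set.Ioc a b, s ∉ ω.jumps) : ω b = ω a := by
  have key : ∀ s, a ≤ s → s ≤ b → ω s = ω a := by
    intro s
    induction s using nnreal_induction with
    | h0 =>
      intro h1 _
      rw [le_antisymm h1 (zero_le (a := a))]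
    | hr t ih =>
      rcases lt_or_ge t a with hta | hta
      · filter_upwards [Ioo_mem_nhdsGT hta] with s hs h1
        exact absurd hs.2 (not_lt.2 h1)
      · filter_upwards [ω.right_cont t, self_mem_nhdsWithin] with s hs hts _ hsb
        exact hs.trans (ih hta ((le_of_lt hts).trans hsb))
    | hl t ht ih =>
      intro hat htb
      rcases eq_or_lt_of_le hat with rfl | hat
      · rfl
      · have h1 := h t ⟨hat, htb⟩
        simp only [jumps, Set.mem_ofPred_eq, not_and, not_not] at h1
        rw [h1 ht]
        refine ω.leftLim_eq ht ?_
        filter_upwards [Ioo_mem_nhdsLT hat] with s hs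
        exact ih s hs.2 hs.1.le (hs.2.le.trans htb)
  exact key b hab le_rfl

/-- The sum of `φ (ω(τ-)) (ω(τ))` over the jump times `τ ≤ t` of `ω`. -/
noncomputable def jumpSum [AddCommMonoid A] (φ : S → S → A) (ω : CadlagPath S) (t : ℝ≥0) : A :=
  ∑ τ ∈ (ω.jumps_finite t).toFinset, φ (ω.leftLim τ) (ω τ)

section

variable [AddCommMonoid A]

theorem jumpSum_zero (φ : S → S → A) (ω : CadlagPath S) : jumpSum φ ω 0 = 0 := by
  refine Finset.sum_eq_zero fun τ hτ => ?_
  rw [Set.Finite.mem_toFinset] at hτ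
  exact absurd hτ.2 (not_le.2 hτ.1.1)

open Classical in
theorem jumpSum_add (φ : S → S → A) (ω : CadlagPath S) {a b : ℝ≥0} (hab : a ≤ b) :
    jumpSum φ ω b = jumpSum φ ω a +
      ∑ τ ∈ (ω.jumps_finite b).toFinset with a < τ, φ (ω.leftLim τ) (ω τ) := by
  unfold jumpSum
  rw [← Finset.sum_filter_add_sum_filter_not (ω.jumps_finite b).toFinset (fun τ => τ ≤ a)]
  congr 1
  · refine Finset.sum_congr ?_ fun _ _ => rfl
    ext τ
    simp only [Finset.mem_filter, Set.Finite.mem_toFinset, Set.mem_inter_iff, Set.mem_Iic]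
    exact ⟨fun h => ⟨h.1.1, h.2⟩, fun h => ⟨⟨h.1, h.2.trans hab⟩, h.2⟩⟩
  · simp only [not_le]

/-- With `δ` below all distances between jump times up to `T`, an interval shorter than `δ` contains
at most one jump, and the path is constant before and after it. This allows the functional to be
computed from values on a fine grid. -/
theorem jumpSum_step (φ : S → S → A) (hφ : ∀ x, φ x x = 0) (ω : CadlagPath S) (T : ℝ≥0) :
    ∃ δ : ℝ≥0, 0 < δ ∧ ∀ a b, a ≤ b → b ≤ T → b < a + δ →
      jumpSum φ ω b = jumpSum φ ω a + φ (ω a) (ω b) := by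
  classical
  have hev : ∀ᶠ δ in 𝓝[>] (0 : ℝ≥0),
      ∀ p ∈ ((ω.jumps_finite T).toFinset ×ˢ (ω.jumps_finite T).toFinset).filter
        (fun p => p.1 < p.2), δ < p.2 - p.1 := by
    rw [Filter.eventually_all_finset]
    intro p hp
    have hp' : 0 < p.2 - p.1 := tsub_pos_of_lt (Finset.mem_filter.1 hp).2
    exact nhdsWithin_le_nhds (Iio_mem_nhds hp')
  obtain ⟨δ, hδ, hδ0⟩ := (hev.and self_mem_nhdsWithin).exists
  refine ⟨δ, hδ0, fun a b hab hbT hbδ => ?_⟩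
  rw [jumpSum_add φ ω hab]
  congr 1
  by_cases hJ : ∃ τ, τ ∈ ω.jumps ∧ a < τ ∧ τ ≤ b
  · obtain ⟨τ, hτ, haτ, hτb⟩ := hJ
    have huniq : ∀ σ, σ ∈ ω.jumps → a < σ → σ ≤ b → σ = τ := by
      have aux : ∀ x y, x ∈ ω.jumps → y ∈ ω.jumps → a < x → y ≤ b → ¬ x < y := by
        intro x y hx hy hax hyb hxy
        have h1 := hδ (x, y) (by
          simp only [Finset.mem_filter, Finset.mem_product, Set.Finite.mem_toFinset]
          exact ⟨⟨⟨hx, (hxy.le.trans hyb).trans hbT⟩, ⟨hy, hyb.trans hbT⟩⟩, hxy⟩)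
        have h2 : x + δ < y := by
          have := lt_tsub_iff_left.1 h1
          exact this
        have h3 : a + δ < b := (add_lt_add_of_lt_of_le hax le_rfl).trans (h2.trans_le hyb)
        exact lt_asymm h3 hbδ
      intro σ hσ haσ hσb
      exact le_antisymm (not_lt.1 (aux τ σ hτ hσ haτ hσb)) (not_lt.1 (aux σ τ hσ hτ haσ hτb))
    have hset : ((ω.jumps_finite b).toFinset.filter fun σ => a < σ) = {τ} := by
      ext σ
      simp only [Finset.mem_filter, Set.Finite.mem_toFinset, Set.mem_inter_iff, Set.mem_Iic,
        Finset.mem_singleton]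
      exact ⟨fun h => huniq σ h.1.1 h.2 h.1.2, fun h => h ▸ ⟨⟨hτ, hτb⟩, haτ⟩⟩
    rw [hset, Finset.sum_singleton]
    have h1 : ω b = ω τ := ω.eq_of_no_jumps hτb fun s hs hsJ =>
      hs.1.ne' (huniq s hsJ (haτ.trans hs.1) hs.2)
    have h2 : ω.leftLim τ = ω a := by
      refine ω.leftLim_eq hτ.1 ?_
      filter_upwards [Ioo_mem_nhdsLT haτ] with s hs
      exact ω.eq_of_no_jumps hs.1.le fun r hr hrJ =>
        (hr.2.trans_lt hs.2).ne (huniq r hrJ hr.1 ((hr.2.trans hs.2.le).trans hτb))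
    rw [h1, h2]
  · rw [ω.eq_of_no_jumps hab fun s hs hsJ => hJ ⟨s, hsJ, hs.1, hs.2⟩, hφ]
    refine Finset.sum_eq_zero fun τ hτ => ?_
    simp only [Finset.mem_filter, Set.Finite.mem_toFinset, Set.mem_inter_iff, Set.mem_Iic] at hτ
    exact absurd ⟨τ, hτ.1.1, hτ.2, hτ.1.2⟩ hJ

theorem eventually_jumpSum_right (φ : S → S → A) (hφ : ∀ x, φ x x = 0) (ω : CadlagPath S)
    (t : ℝ≥0) : ∀ᶠ s in 𝓝[>] t, jumpSum φ ω s = jumpSum φ ω t := by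
  obtain ⟨δ, hδ0, hδ⟩ := jumpSum_step φ hφ ω (t + 1)
  filter_upwards [ω.right_cont t, Ioo_mem_nhdsGT (lt_add_of_pos_right t hδ0),
    Ioo_mem_nhdsGT (lt_add_one t)] with s hs h1 h2
  rw [hδ t s h1.1.le h2.2.le h1.2, hs, hφ, add_zero]

theorem eventually_jumpSum_left (φ : S → S → A) (hφ : ∀ x, φ x x = 0) (ω : CadlagPath S)
    {t : ℝ≥0} (ht : 0 < t) : ∃ u, (∀ᶠ s in 𝓝[<] t, jumpSum φ ω s = u) ∧
      jumpSum φ ω t = u + φ (ω.leftLim t) (ω t) := by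
  obtain ⟨δ, hδ0, hδ⟩ := jumpSum_step φ hφ ω t
  have hnear : ∀ᶠ s in 𝓝[<] t, t < s + δ := by
    refine nhdsWithin_le_nhds ?_
    exact (continuous_id.add continuous_const).continuousAt.eventually
      (lt_mem_nhds (lt_add_of_pos_right t hδ0))
  obtain ⟨b, hb, hsub⟩ := (mem_nhdsLT_iff_exists_Ioo_subset' ht).1
    ((ω.leftLim_spec t).and hnear)
  -- From `s₀` on, the path already has its left limit at `t` and `t` is less than `δ` away; the
  -- value of the functional at `s₀` is therefore its left limit.
  obtain ⟨s₀, hs₀, hs₀t⟩ := exists_between (show b < t from hb)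
  have hs₀' := hsub ⟨hs₀, hs₀t⟩
  refine ⟨jumpSum φ ω s₀, ?_, ?_⟩
  · filter_upwards [Ioo_mem_nhdsLT hs₀t] with s hs
    have hs' := hsub (show s ∈ Set.Ioo b t from ⟨hs₀.trans hs.1, hs.2⟩)
    rw [hδ s₀ s hs.1.le hs.2.le (hs.2.trans hs₀'.2), hs'.1, hs₀'.1, hφ, add_zero]
  · rw [hδ s₀ t hs₀t.le le_rfl hs₀'.2, hs₀'.1]

/-- The path `t ↦ R (ω t) (c t)`, where `c` is the additive functional `jumpSum φ ω`. -/
noncomputable def extend {S' : Type*} (φ : S → S → A) (hφ : ∀ x, φ x x = 0) (R : S → A → S')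
    (ω : CadlagPath S) : CadlagPath S' where
  toFun t := R (ω t) (jumpSum φ ω t)
  right_cont t := by
    filter_upwards [ω.right_cont t, eventually_jumpSum_right φ hφ ω t] with s h1 h2
    rw [h1, h2]
  left_lim t := by
    rcases eq_or_lt_of_le (zero_le (a := t)) with rfl | ht
    · have : 𝓝[<] (0 : ℝ≥0) = ⊥ := by
        have : Set.Iio (0 : ℝ≥0) = ∅ := by ext; simp
        rw [this, nhdsWithin_empty]
      exact ⟨R (ω 0) 0, by rw [this]; exact eventually_bot⟩
    · obtain ⟨u, hu, -⟩ := eventually_jumpSum_left φ hφ ω ht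
      refine ⟨R (ω.leftLim t) u, ?_⟩
      filter_upwards [ω.leftLim_spec t, hu] with s h1 h2
      rw [h1, h2]

end

theorem extend_apply {S' : Type*} [AddCommMonoid A] (φ : S → S → A) (hφ : ∀ x, φ x x = 0)
    (R : S → A → S') (ω : CadlagPath S) (t : ℝ≥0) :
    extend φ hφ R ω t = R (ω t) (jumpSum φ ω t) := rfl

theorem jumpSum_mono (φ : S → S → ℕ) (ω : CadlagPath S) : Monotone (jumpSum φ ω) := fun a b hab => by
  classical
  rw [jumpSum_add φ ω hab]
  exact Nat.le_add_right _ _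

/-- The number of jumps up to a given time. -/
noncomputable def jumpCount (ω : CadlagPath S) (t : ℝ≥0) : ℕ := jumpSum (fun _ _ => 1) ω t

/-- Counting jumps turns constancy on an interval into an equality of integers, which is used to
bound Riemann sum errors. -/
theorem eq_of_jumpCount_eq (ω : CadlagPath S) {a b : ℝ≥0} (hab : a ≤ b)
    (h : ω.jumpCount a = ω.jumpCount b) : ω b = ω a := by
  classical
  refine ω.eq_of_no_jumps hab fun s hs hsJ => ?_
  have h1 := jumpSum_add (fun _ _ => 1) ω hab
  have h2 : ∑ τ ∈ (ω.jumps_finite b).toFinset with a < τ, 1 = 0 := by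
    unfold jumpCount at h
    omega
  rw [Finset.sum_eq_zero_iff] at h2
  refine one_ne_zero (h2 s ?_)
  simp only [Finset.mem_filter, Set.Finite.mem_toFinset]
  exact ⟨⟨hsJ, hs.2⟩, hs.1⟩

end CadlagPath

end FepSwt

/-! ### Discretization along grids and measurability of path functionals -/

namespace FepSwt

/-- When the sequence is eventually equal to its limit, preimages are lower limits of preimages; no
topology on `E` is involved. -/
theorem measurable_of_eventually_eq {Ω E : Type*} {m : MeasurableSpace Ω} [MeasurableSpace E]
    {f : ℕ → Ω → E} {g : Ω → E} (hf : ∀ n, Measurable (f n))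
    (h : ∀ ω, ∀ᶠ n in atTop, f n ω = g ω) : Measurable g := by
  intro B hB
  have : g ⁻¹' B = ⋃ k : ℕ, ⋂ n : ℕ, ⋂ _ : k ≤ n, f n ⁻¹' B := by
    ext ω
    simp only [Set.mem_preimage, Set.mem_iUnion, Set.mem_iInter]
    obtain ⟨k, hk⟩ := eventually_atTop.1 (h ω)
    constructor
    · exact fun hg => ⟨k, fun n hn => by rwa [hk n hn]⟩
    · rintro ⟨l, hl⟩
      have := hl (max k l) (le_max_right _ _)
      rwa [hk _ (le_max_left _ _)] at this
  rw [this]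
  exact MeasurableSet.iUnion fun k => MeasurableSet.iInter fun n => MeasurableSet.iInter fun _ =>
    hf n hB

/-- The regular grid with `n` cells on `[s, t]`. -/
noncomputable def grid (s t : ℝ≥0) (n i : ℕ) : ℝ≥0 := s + i * ((t - s) / n)

theorem grid_zero (s t : ℝ≥0) (n : ℕ) : grid s t n 0 = s := by simp [grid]

theorem grid_last {s t : ℝ≥0} (hst : s ≤ t) {n : ℕ} (hn : n ≠ 0) : grid s t n n = t := by
  have : (n : ℝ≥0) ≠ 0 := by exact_mod_cast hn
  rw [grid, mul_div_cancel₀ _ this, add_tsub_cancel_of_le hst]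

theorem grid_succ (s t : ℝ≥0) (n i : ℕ) : grid s t n (i + 1) = grid s t n i + (t - s) / n := by
  simp only [grid]; push_cast; ring

theorem grid_mono (s t : ℝ≥0) (n : ℕ) : Monotone (grid s t n) :=
  monotone_nat_of_le_succ fun i => by rw [grid_succ]; exact le_self_add

theorem le_grid (s t : ℝ≥0) (n i : ℕ) : s ≤ grid s t n i := le_self_add

theorem grid_le {s t : ℝ≥0} (hst : s ≤ t) {n i : ℕ} (hi : i ≤ n) : grid s t n i ≤ t := by
  rcases Nat.eq_zero_or_pos n with rfl | hn
  · rw [Nat.le_zero.1 hi, grid_zero]; exact hst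
  · exact (grid_mono s t n hi).trans_eq (grid_last hst hn.ne')

theorem tendsto_mesh (s t : ℝ≥0) : Tendsto (fun n : ℕ => (t - s) / (n : ℝ≥0)) atTop (𝓝 0) :=
  tendsto_const_div_atTop_nhds_zero_nat (t - s)

namespace CadlagPath

variable {S A E : Type*}

theorem eventually_jumpSum_grid [AddCommMonoid A] (φ : S → S → A) (hφ : ∀ x, φ x x = 0)
    (ω : CadlagPath S) {s t : ℝ≥0} (hst : s ≤ t) :
    ∀ᶠ n : ℕ in atTop, ∀ i ≤ n, jumpSum φ ω (grid s t n i) = jumpSum φ ω s +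
      ∑ l ∈ Finset.range i, φ (ω (grid s t n l)) (ω (grid s t n (l + 1))) := by
  obtain ⟨δ, hδ0, hδ⟩ := jumpSum_step φ hφ ω t
  filter_upwards [(tendsto_mesh s t).eventually (Iio_mem_nhds hδ0)] with n hn i hi
  induction i with
  | zero => simp [grid_zero]
  | succ i ih =>
    rw [Finset.sum_range_succ, ← add_assoc, ← ih (Nat.le_of_succ_le hi)]
    refine hδ _ _ (grid_mono s t n (Nat.le_succ i)) (grid_le hst hi) ?_
    rw [grid_succ]
    gcongr

theorem measurable_eval {F : Type*} [MeasurableSpace F] (ψ : S → F) {s t : ℝ≥0} (hst : s ≤ t) :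
    Measurable[canonicalFiltration S t] (fun ω : CadlagPath S => ψ (ω s)) := by
  intro B _
  have h1 : MeasurableSpace.comap (fun ω : CadlagPath S => ω s) ⊤ ≤ canonicalFiltration S t :=
    le_iSup₂ (f := fun (r : ℝ≥0) (_ : r ≤ t) =>
      MeasurableSpace.comap (fun ω : CadlagPath S => ω r) ⊤) s hst
  exact h1 _ ⟨ψ ⁻¹' B, trivial, rfl⟩

theorem measurable_of_eval {Ω : Type*} {m : MeasurableSpace Ω} {Ψ : Ω → CadlagPath S}
    (h : ∀ t, Measurable[m, ⊤] fun ω => Ψ ω t) : Measurable Ψ := by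
  rw [measurable_iff_comap_le]
  change MeasurableSpace.comap Ψ (⨆ t, _) ≤ m
  rw [MeasurableSpace.comap_iSup]
  refine iSup_le fun t => ?_
  rw [MeasurableSpace.comap_comp]
  exact measurable_iff_comap_le.1 (h t)

theorem measurable_real (x : CadlagPath E) (ψ : E → ℝ) :
    Measurable fun v : ℝ => ψ (x v.toNNReal) := by
  suffices h : Measurable fun v : ℝ≥0 => ψ (x v) from h.comp measurable_real_toNNReal
  -- The approximating times are grid points strictly to the right of `v` and tend to `v`, so right
  -- continuity makes the values eventually equal to the value at `v`.
  refine measurable_of_eventually_eq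
    (f := fun (n : ℕ) (v : ℝ≥0) => ψ (x ((⌊v * (n + 1)⌋₊ + 1) / (n + 1)))) (fun n => ?_) fun v => ?_
  · exact (measurable_from_nat (f := fun k : ℕ => ψ (x ((k + 1) / (n + 1))))).comp
      (Nat.measurable_floor.comp (measurable_id.mul_const _))
  · obtain ⟨b, hb, hsub⟩ :=
      (mem_nhdsGT_iff_exists_Ioo_subset' (lt_add_one v)).1 (x.right_cont v)
    have h1 := (tendsto_one_div_add_atTop_nhds_zero_nat (𝕜 := ℝ≥0)).eventually
      (Iio_mem_nhds (tsub_pos_of_lt hb))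
    filter_upwards [h1] with n hn
    have hpos : (0 : ℝ≥0) < n + 1 := by positivity
    have hmem : ((⌊v * (n + 1)⌋₊ + 1) / (n + 1) : ℝ≥0) ∈ Set.Ioo v b := by
      constructor
      · rw [lt_div_iff₀ hpos]
        exact Nat.lt_floor_add_one _
      · calc ((⌊v * (n + 1)⌋₊ + 1) / (n + 1) : ℝ≥0) ≤ (v * (n + 1) + 1) / (n + 1) := by
              gcongr
              exact Nat.floor_le zero_le
          _ = v + 1 / (n + 1) := by field_simp
          _ < v + (b - v) := by gcongr
          _ = b := add_tsub_cancel_of_le (le_of_lt hb)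
    have := hsub hmem
    simp only [Set.mem_ofPred_eq] at this
    rw [this]

theorem intervalIntegrable (x : CadlagPath E) {ψ : E → ℝ} {C : ℝ} (hC : ∀ e, |ψ e| ≤ C)
    (a b : ℝ) : IntervalIntegrable (fun v : ℝ => ψ (x v.toNNReal)) volume a b := by
  rw [intervalIntegrable_iff]
  refine Measure.integrableOn_of_bounded (M := C) ?_ (x.measurable_real ψ).aestronglyMeasurable
    (Eventually.of_forall fun v => hC _)
  simp [Set.uIoc]

theorem abs_integral_le (x : CadlagPath E) {ψ : E → ℝ} {C : ℝ} (hC : ∀ e, |ψ e| ≤ C)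
    {a b : ℝ≥0} (hab : a ≤ b) : |∫ v in (a : ℝ)..b, ψ (x v.toNNReal)| ≤ C * (b - a) := by
  have h := intervalIntegral.norm_integral_le_of_norm_le_const (a := (a : ℝ)) (b := b)
    (f := fun v => ψ (x v.toNNReal)) (C := C) fun v _ => hC _
  rwa [abs_of_nonneg (sub_nonneg.2 (NNReal.coe_le_coe.2 hab))] at h

theorem jumpCount_mono (x : CadlagPath E) : Monotone x.jumpCount := jumpSum_mono _ x

/-- Without a jump in the cell the integrands coincide. Otherwise the increment of the jump count is
at least `1` and the crude bound `2 * C * (b - a)` suffices. This form telescopes: over a grid the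
total error is at most a constant times the mesh times the number of jumps. -/
theorem cell_error (x : CadlagPath E) {H : E → E → ℝ} {C : ℝ} (hC : ∀ e e', |H e e'| ≤ C)
    {a b : ℝ≥0} (hab : a ≤ b) :
    |(∫ v in (a : ℝ)..b, H (x a) (x v.toNNReal)) -
      ∫ v in (a : ℝ)..b, H (x v.toNNReal) (x v.toNNReal)| ≤
      2 * C * (b - a) * (x.jumpCount b - x.jumpCount a) := by
  have hab' : (a : ℝ) ≤ b := NNReal.coe_le_coe.2 hab
  have hC0 : 0 ≤ C := (abs_nonneg _).trans (hC (x 0) (x 0))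
  rcases eq_or_lt_of_le (x.jumpCount_mono hab) with h | h
  · rw [h, sub_self, mul_zero]
    refine (abs_eq_zero.2 (sub_eq_zero.2 (intervalIntegral.integral_congr fun v hv => ?_))).le
    rw [Set.uIcc_of_le hab'] at hv
    have h1 : a ≤ v.toNNReal := NNReal.le_toNNReal_of_coe_le hv.1
    have h2 : v.toNNReal ≤ b := Real.toNNReal_le_iff_le_coe.2 hv.2
    have h3 : x v.toNNReal = x a := x.eq_of_jumpCount_eq h1
      (le_antisymm (x.jumpCount_mono h1) (h ▸ x.jumpCount_mono h2))
    simp only [h3]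
  · have h1 := x.abs_integral_le (hC (x a)) hab
    have h2 := x.abs_integral_le (ψ := fun e => H e e) (fun e => hC e e) hab
    have h3 : (1 : ℝ) ≤ x.jumpCount b - x.jumpCount a := by
      have : (x.jumpCount a : ℝ) + 1 ≤ x.jumpCount b := by exact_mod_cast h
      linarith
    calc _ ≤ C * (b - a) + C * (b - a) := (abs_sub _ _).trans (add_le_add h1 h2)
      _ = 2 * C * (b - a) * 1 := by ring
      _ ≤ _ := mul_le_mul_of_nonneg_left h3
        (mul_nonneg (by positivity) (sub_nonneg.2 hab'))

/-- Riemann sums along a regular grid, with the first argument frozen on each cell, converge. -/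
theorem tendsto_grid_sum (x : CadlagPath E) {H : E → E → ℝ} {C : ℝ}
    (hC : ∀ e e', |H e e'| ≤ C) {s t : ℝ≥0} (hst : s ≤ t) :
    Tendsto (fun n : ℕ => ∑ i ∈ Finset.range n,
      ∫ v in (grid s t n i : ℝ)..grid s t n (i + 1), H (x (grid s t n i)) (x v.toNNReal))
      atTop (𝓝 (∫ v in (s : ℝ)..t, H (x v.toNNReal) (x v.toNNReal))) := by
  rw [tendsto_iff_norm_sub_tendsto_zero]
  have hlim : Tendsto (fun n : ℕ => 2 * C * (((t - s) / (n : ℝ≥0) : ℝ≥0) : ℝ) *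
      (x.jumpCount t - x.jumpCount s)) atTop (𝓝 0) := by
    have h := (NNReal.tendsto_coe.2 (tendsto_mesh s t)).const_mul (2 * C)
    simpa using h.mul_const ((x.jumpCount t : ℝ) - x.jumpCount s)
  refine squeeze_zero' (Eventually.of_forall fun _ => norm_nonneg _) ?_ hlim
  filter_upwards [eventually_ne_atTop 0] with n hn
  have hadj := intervalIntegral.sum_integral_adjacent_intervals (μ := volume)
    (f := fun v => H (x v.toNNReal) (x v.toNNReal)) (a := fun i => (grid s t n i : ℝ)) (n := n)
    fun i _ => x.intervalIntegrable (ψ := fun e => H e e) (fun e => hC e e) _ _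
  simp only [grid_zero, grid_last hst hn] at hadj
  rw [← hadj, ← Finset.sum_sub_distrib]
  have htel := Finset.sum_range_sub (fun i => (x.jumpCount (grid s t n i) : ℝ)) n
  rw [grid_zero, grid_last hst hn] at htel
  calc _ ≤ ∑ i ∈ Finset.range n, 2 * C * (((t - s) / (n : ℝ≥0) : ℝ≥0) : ℝ) *
        (x.jumpCount (grid s t n (i + 1)) - x.jumpCount (grid s t n i)) := by
        refine (norm_sum_le _ _).trans (Finset.sum_le_sum fun i _ => ?_)
        have h := x.cell_error hC (grid_mono s t n (Nat.le_succ i))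
        rw [grid_succ] at h ⊢
        rw [NNReal.coe_add, add_sub_cancel_left] at h
        rw [NNReal.coe_add]
        exact h
    _ = _ := by rw [← Finset.mul_sum, htel]

/-- The integral is a limit of Riemann sums which use only values up to time `t`, hence it is
adapted and not merely measurable. -/
theorem measurable_integral (ψ : E → ℝ) {C : ℝ} (hC : ∀ e, |ψ e| ≤ C) {s t : ℝ≥0} (hst : s ≤ t) :
    Measurable[canonicalFiltration E t]
      fun x : CadlagPath E => ∫ v in (s : ℝ)..t, ψ (x v.toNNReal) := by
  refine @measurable_of_tendsto_metrizable _ _ (canonicalFiltration E t) _ _ _ _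
    (f := fun (n : ℕ) (x : CadlagPath E) => ∑ i ∈ Finset.range n,
      (((grid s t n (i + 1) : ℝ) - grid s t n i) * ψ (x (grid s t n i)))) _ ?_ ?_
  · intro n
    refine Finset.measurable_sum _ fun i hi => Measurable.const_mul ?_ _
    exact measurable_eval ψ (grid_le hst (Finset.mem_range.1 hi).le)
  · rw [tendsto_pi_nhds]
    intro x
    have h := x.tendsto_grid_sum (H := fun e _ => ψ e) (fun e _ => hC e) hst
    simpa using h

variable [Countable S] [MeasurableSpace S] [DiscreteMeasurableSpace S]
  [Countable A] [MeasurableSpace A] [DiscreteMeasurableSpace A]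

omit [Countable A] [DiscreteMeasurableSpace A] in
theorem measurable_eval_eval (φ : S → S → A) {r s t : ℝ≥0} (hr : r ≤ t) (hs : s ≤ t) :
    Measurable[canonicalFiltration S t] (fun ω : CadlagPath S => φ (ω r) (ω s)) :=
  (Measurable.of_discrete (f := fun p : S × S => φ p.1 p.2)).comp
    (Measurable.prodMk (measurable_eval id hr) (measurable_eval id hs))

theorem measurable_jumpSum [AddCommMonoid A] (φ : S → S → A) (hφ : ∀ x, φ x x = 0)
    {s t : ℝ≥0} (hst : s ≤ t) :
    Measurable[canonicalFiltration S t] (fun ω : CadlagPath S => jumpSum φ ω s) := by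
  have : MeasurableAdd₂ A := ⟨.of_discrete⟩
  refine @measurable_of_eventually_eq _ _ (canonicalFiltration S t) _
    (fun (n : ℕ) ω => ∑ l ∈ Finset.range n, φ (ω (grid 0 s n l)) (ω (grid 0 s n (l + 1)))) _ ?_ ?_
  · intro n
    refine Finset.measurable_sum _ fun l hl => ?_
    exact measurable_eval_eval φ ((grid_le zero_le (Finset.mem_range.1 hl).le).trans hst)
      ((grid_le zero_le (Finset.mem_range.1 hl)).trans hst)
  · intro ω
    filter_upwards [eventually_jumpSum_grid φ hφ ω (zero_le (a := s)),
      eventually_ne_atTop 0] with n hn hn0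
    have := hn n le_rfl
    rw [grid_last zero_le hn0, jumpSum_zero, zero_add] at this
    exact this.symm

end CadlagPath

end FepSwt

/-! ### Martingale problems with an additive functional of the jumps -/

namespace FepSwt

/-- The operator `L` is bounded by `B` for the uniform norm. -/
def IsBoundedOp {S : Type*} (L : (S → ℝ) → S → ℝ) (B : ℝ) : Prop :=
  ∀ (f : S → ℝ) (C : ℝ), (∀ x, |f x| ≤ C) → ∀ x, |L f x| ≤ B * C

namespace CadlagPath

variable {S A E : Type*}

/-- The increment over `[a, b]` of the martingale attached to `L` and `f`. -/
noncomputable def increment (L : (S → ℝ) → S → ℝ) (f : S → ℝ) (a b : ℝ≥0) (ω : CadlagPath S) : ℝ :=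
  f (ω b) - f (ω a) - ∫ v in (a : ℝ)..b, L f (ω v.toNNReal)

variable {L : (S → ℝ) → S → ℝ} {B : ℝ}

theorem measurable_increment (hL : IsBoundedOp L B) {f : S → ℝ} {C : ℝ} (hf : ∀ x, |f x| ≤ C)
    {a b : ℝ≥0} (hab : a ≤ b) : Measurable[canonicalFiltration S b] (increment L f a b) :=
  ((measurable_eval f le_rfl).sub (measurable_eval f hab)).sub
    (measurable_integral (L f) (hL f C hf) hab)

theorem abs_increment_le (hL : IsBoundedOp L B) {f : S → ℝ} {C : ℝ} (hf : ∀ x, |f x| ≤ C)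
    {a b : ℝ≥0} (hab : a ≤ b) (ω : CadlagPath S) :
    |increment L f a b ω| ≤ C + C + B * C * (b - a) :=
  (abs_sub _ _).trans (add_le_add ((abs_sub _ _).trans (add_le_add (hf _) (hf _)))
    (ω.abs_integral_le (hL f C hf) hab))

theorem increment_sub (hL : IsBoundedOp L B) {f : S → ℝ} {C : ℝ} (hf : ∀ x, |f x| ≤ C)
    (a b : ℝ≥0) (ω : CadlagPath S) :
    increment L f 0 b ω - increment L f 0 a ω = increment L f a b ω := by
  have h := intervalIntegral.integral_interval_sub_left
    (ω.intervalIntegrable (hL f C hf) 0 b) (ω.intervalIntegrable (hL f C hf) 0 a)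
  simp only [increment, NNReal.coe_zero]
  rw [← h]
  ring

theorem setIntegral_increment (hL : IsBoundedOp L B) {x₀ : S} {μ : Measure (CadlagPath S)}
    (hμ : IsMarkovLaw L x₀ μ) {f : S → ℝ} {C : ℝ} (hf : ∀ x, |f x| ≤ C) {a b : ℝ≥0} (hab : a ≤ b)
    {D : Set (CadlagPath S)} (hD : MeasurableSet[canonicalFiltration S a] D) :
    ∫ ω in D, increment L f a b ω ∂μ = 0 := by
  have := hμ.isProb
  have hM : Martingale (fun t => increment L f 0 t) (canonicalFiltration S) μ := by
    have := hμ.martingale f ⟨C, hf⟩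
    exact this
  simp_rw [← increment_sub hL hf a b]
  rw [integral_sub (hM.integrable b).integrableOn (hM.integrable a).integrableOn,
    hM.setIntegral_eq hab hD, sub_self]

theorem measurable_increment_comp [Countable E] [MeasurableSpace E] [DiscreteMeasurableSpace E]
    (hL : IsBoundedOp L B) {f : E → S → ℝ} {C : ℝ} (hf : ∀ e x, |f e x| ≤ C) {a b : ℝ≥0}
    (hab : a ≤ b) {Z : CadlagPath S → E} (hZ : Measurable[canonicalFiltration S b] Z) :
    Measurable[canonicalFiltration S b] fun ω => increment L (f (Z ω)) a b ω := by
  have h : Measurable[(inferInstance : MeasurableSpace E).prod (canonicalFiltration S b)]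
      fun p : E × CadlagPath S => increment L (f p.1) a b p.2 :=
    @measurable_from_prod_countable_right _ _ _ _ (canonicalFiltration S b) _ _ _ _
      fun e => measurable_increment hL (hf e) hab
  have h2 : Measurable[canonicalFiltration S b,
      (inferInstance : MeasurableSpace E).prod (canonicalFiltration S b)]
      fun ω : CadlagPath S => (Z ω, ω) := by
    refine @Measurable.prodMk _ (canonicalFiltration S b) _ _ _ (canonicalFiltration S b) _ _ hZ ?_
    exact @measurable_id _ (canonicalFiltration S b)
  exact h.comp h2

/-- The increment of the martingale over `[a, b]` has zero mean also when the function is chosen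
depending on the past of `a`. -/
theorem setIntegral_increment_comp [Countable E] [MeasurableSpace E] [DiscreteMeasurableSpace E]
    (hL : IsBoundedOp L B) {x₀ : S} {μ : Measure (CadlagPath S)} (hμ : IsMarkovLaw L x₀ μ)
    {f : E → S → ℝ} {C : ℝ} (hf : ∀ e x, |f e x| ≤ C) {a b : ℝ≥0} (hab : a ≤ b)
    {Z : CadlagPath S → E} (hZ : Measurable[canonicalFiltration S a] Z)
    {D : Set (CadlagPath S)} (hD : MeasurableSet[canonicalFiltration S a] D) :
    ∫ ω in D, increment L (f (Z ω)) a b ω ∂μ = 0 := by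
  have := hμ.isProb
  have hD' : ∀ e : E, MeasurableSet[canonicalFiltration S a] (D ∩ Z ⁻¹' {e}) := fun e =>
    hD.inter (hZ (MeasurableSet.of_discrete (s := {e})))
  -- On each piece the function is deterministic and the martingale property applies; countability
  -- of `E` allows summation.
  have hU : D = ⋃ e : E, D ∩ Z ⁻¹' {e} := by
    ext ω
    simp
  have hmeas := measurable_increment_comp hL hf hab
    (hZ.mono ((canonicalFiltration S).mono hab) le_rfl)
  have hint : Integrable (fun ω => increment L (f (Z ω)) a b ω) μ :=
    Integrable.of_bound
      (hmeas.mono ((canonicalFiltration S).le b) le_rfl).aestronglyMeasurable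
      (C + C + B * C * (b - a))
      (Eventually.of_forall fun ω => abs_increment_le hL (hf (Z ω)) hab ω)
  have hsum := hasSum_integral_iUnion (μ := μ) (f := fun ω => increment L (f (Z ω)) a b ω)
    (fun e => (canonicalFiltration S).le a _ (hD' e))
    (fun e e' hne => Set.disjoint_left.2 fun ω h h' => hne (h.2.symm.trans h'.2))
    hint.integrableOn
  rw [← hU] at hsum
  refine hsum.unique ?_
  convert hasSum_zero with e
  rw [← setIntegral_increment hL hμ (hf e) hab (hD' e)]
  refine setIntegral_congr_fun ((canonicalFiltration S).le a _ (hD' e)) fun ω hω => ?_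
  have h1 : Z ω = e := hω.2
  simp only [h1]

variable [Countable S] [MeasurableSpace S] [DiscreteMeasurableSpace S]
  [AddCommMonoid A] [Countable A] [MeasurableSpace A] [DiscreteMeasurableSpace A]

/-- The martingale problem for the pair formed by a Markov process and an additive functional of
its jumps. -/
theorem setIntegral_jumpSum (hL : IsBoundedOp L B) {x₀ : S} {μ : Measure (CadlagPath S)}
    (hμ : IsMarkovLaw L x₀ μ) (φ : S → S → A) (hφ : ∀ x, φ x x = 0)
    {F : S → A → ℝ} {C : ℝ} (hF : ∀ x u, |F x u| ≤ C) {s t : ℝ≥0} (hst : s ≤ t)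
    {D : Set (CadlagPath S)} (hD : MeasurableSet[canonicalFiltration S s] D) :
    ∫ ω in D, (F (ω t) (jumpSum φ ω t) - F (ω s) (jumpSum φ ω s) -
      ∫ v in (s : ℝ)..t, L (fun y => F y (jumpSum φ ω v.toNNReal + φ (ω v.toNNReal) y))
        (ω v.toNNReal)) ∂μ = 0 := by
  have := hμ.isProb
  have hadd : MeasurableAdd₂ A := ⟨.of_discrete⟩
  -- Test function for one cell: `e` holds the state and the functional at the left end, and the
  -- functional is updated as if the path jumped directly from that state to `y`.
  let f : S × A → S → ℝ := fun e y => F y (e.2 + φ e.1 y)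
  have hf : ∀ e x, |f e x| ≤ C := fun e x => hF _ _
  let u : ℕ → ℕ → CadlagPath S → A := fun n i ω =>
    jumpSum φ ω s + ∑ l ∈ Finset.range i, φ (ω (grid s t n l)) (ω (grid s t n (l + 1)))
  let Z : ℕ → ℕ → CadlagPath S → S × A := fun n i ω => (ω (grid s t n i), u n i ω)
  have hZ : ∀ n i, Measurable[canonicalFiltration S (grid s t n i)] (Z n i) := fun n i => by
    refine Measurable.prodMk (measurable_eval id le_rfl) ?_
    refine (measurable_jumpSum φ hφ (le_grid s t n i)).add (Finset.measurable_sum _ fun l hl => ?_)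
    exact measurable_eval_eval φ (grid_mono s t n (Finset.mem_range.1 hl).le)
      (grid_mono s t n (Finset.mem_range.1 hl))
  let P : ℕ → CadlagPath S → ℝ := fun n ω => ∑ i ∈ Finset.range n,
    increment L (f (Z n i ω)) (grid s t n i) (grid s t n (i + 1)) ω
  have hPmeas : ∀ n i, Measurable
      fun ω => increment L (f (Z n i ω)) (grid s t n i) (grid s t n (i + 1)) ω := fun n i =>
    (measurable_increment_comp hL hf (grid_mono s t n (Nat.le_succ i))
      ((hZ n i).mono ((canonicalFiltration S).mono (grid_mono s t n (Nat.le_succ i))) le_rfl)).mono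
      ((canonicalFiltration S).le _) le_rfl
  have hPeq : ∀ n, n ≠ 0 → ∀ ω, P n ω = F (ω t) (u n n ω) - F (ω s) (jumpSum φ ω s) -
      ∑ i ∈ Finset.range n, ∫ v in (grid s t n i : ℝ)..grid s t n (i + 1),
        L (f (Z n i ω)) (ω v.toNNReal) := by
    intro n hn ω
    -- At the right end the test function uses the updated value `u n (i + 1)`, at the left end `φ x
    -- x = 0` leaves `u n i`: the boundary terms telescope.
    have h1 : ∀ i, increment L (f (Z n i ω)) (grid s t n i) (grid s t n (i + 1)) ω =
        (F (ω (grid s t n (i + 1))) (u n (i + 1) ω) - F (ω (grid s t n i)) (u n i ω)) -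
        ∫ v in (grid s t n i : ℝ)..grid s t n (i + 1), L (f (Z n i ω)) (ω v.toNNReal) := by
      intro i
      simp only [increment, f, Z, u, hφ, add_zero, Finset.sum_range_succ, add_assoc]
    simp only [P, h1]
    rw [Finset.sum_sub_distrib,
      Finset.sum_range_sub (fun i => F (ω (grid s t n i)) (u n i ω)), grid_last hst hn, grid_zero]
    simp [u]
  have hPbound : ∀ n, n ≠ 0 → ∀ ω, |P n ω| ≤ C + C + B * C * (t - s) := by
    intro n hn ω
    rw [hPeq n hn]
    refine (abs_sub _ _).trans (add_le_add ((abs_sub _ _).trans (add_le_add (hF _ _) (hF _ _))) ?_)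
    have htel := Finset.sum_range_sub (fun i => (grid s t n i : ℝ)) n
    rw [grid_zero, grid_last hst hn] at htel
    rw [← htel, Finset.mul_sum]
    exact (Finset.abs_sum_le_sum_abs _ _).trans (Finset.sum_le_sum fun i _ =>
      ω.abs_integral_le (hL _ C (hf (Z n i ω))) (grid_mono s t n (Nat.le_succ i)))
  have hlim : ∀ ω, Tendsto (fun n => P n ω) atTop (𝓝 (F (ω t) (jumpSum φ ω t) -
      F (ω s) (jumpSum φ ω s) - ∫ v in (s : ℝ)..t,
        L (fun y => F y (jumpSum φ ω v.toNNReal + φ (ω v.toNNReal) y)) (ω v.toNNReal))) := by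
    intro ω
    -- The pair (state, functional) is itself a càdlàg path, so the Riemann sum lemma applies to it,
    -- with the frozen pair as first argument.
    have hR := (extend φ hφ Prod.mk ω).tendsto_grid_sum
      (H := fun e e' => L (f e) e'.1) (C := B * C) (fun e e' => hL _ C (hf e) _) hst
    refine ((tendsto_const_nhds (x := F (ω t) (jumpSum φ ω t) -
      F (ω s) (jumpSum φ ω s))).sub hR).congr' ?_
    filter_upwards [eventually_jumpSum_grid φ hφ ω hst, eventually_ne_atTop 0] with n hn hn0
    rw [hPeq n hn0]
    have h1 := hn n le_rfl
    rw [grid_last hst hn0] at h1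
    rw [h1]
    congr 1
    refine Finset.sum_congr rfl fun i hi => ?_
    simp only [extend_apply, Z, u]
    rw [hn i (Finset.mem_range.1 hi).le]
  have hzero : ∀ n, ∫ ω in D, P (n + 1) ω ∂μ = 0 := by
    intro n
    simp only [P]
    rw [integral_finsetSum]
    · refine Finset.sum_eq_zero fun i hi => ?_
      exact setIntegral_increment_comp hL hμ hf (grid_mono s t (n + 1) (Nat.le_succ i)) (hZ _ i)
        ((canonicalFiltration S).mono (le_grid s t (n + 1) i) _ hD)
    · intro i _
      exact Integrable.of_bound (hPmeas (n + 1) i).aestronglyMeasurable _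
        (Eventually.of_forall fun ω =>
          abs_increment_le hL (hf _) (grid_mono s t (n + 1) (Nat.le_succ i)) ω)
  -- The grid sums have zero mean, converge for every path and are uniformly bounded; the shift to
  -- `n + 1` avoids the empty grid.
  have hconv := tendsto_integral_of_dominated_convergence (μ := μ.restrict D)
    (F := fun n => P (n + 1)) (fun _ => C + C + B * C * (t - s))
    (fun n => (Finset.measurable_sum _ fun i _ => hPmeas (n + 1) i).aestronglyMeasurable)
    (integrable_const _)
    (fun n => Eventually.of_forall fun ω => hPbound (n + 1) n.succ_ne_zero ω)
    (Eventually.of_forall fun ω => (hlim ω).comp (tendsto_add_atTop_nat 1))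
  simp only [hzero] at hconv
  exact tendsto_nhds_unique hconv tendsto_const_nhds

theorem measurable_extend_eval {S' : Type*} (φ : S → S → A) (hφ : ∀ x, φ x x = 0) (R : S → A → S')
    {s t : ℝ≥0} (hst : s ≤ t) :
    Measurable[canonicalFiltration S t, ⊤] (fun ω => extend φ hφ R ω s) :=
  @Measurable.comp _ _ _ (canonicalFiltration S t) _ ⊤ (fun p : S × A => R p.1 p.2)
    (fun ω => (ω s, jumpSum φ ω s)) (fun _ _ => MeasurableSet.of_discrete)
    (Measurable.prodMk (measurable_eval id hst) (measurable_jumpSum φ hφ hst))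

theorem measurable_extend {S' : Type*} (φ : S → S → A) (hφ : ∀ x, φ x x = 0) (R : S → A → S') :
    Measurable (extend φ hφ R) :=
  measurable_of_eval fun t =>
    (measurable_extend_eval φ hφ R le_rfl).mono ((canonicalFiltration S).le t) le_rfl

/-- The past of the image path is contained in the past of the original one. The martingale property
of the original process can thus be tested on events of the image filtration. -/
theorem measurable_extend_canonical {S' : Type*} (φ : S → S → A) (hφ : ∀ x, φ x x = 0)
    (R : S → A → S') (t : ℝ≥0) :
    Measurable[canonicalFiltration S t, canonicalFiltration S' t] (extend φ hφ R) := by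
  rw [measurable_iff_comap_le]
  change MeasurableSpace.comap (extend φ hφ R) (⨆ s, ⨆ _ : s ≤ t, _) ≤ _
  simp only [MeasurableSpace.comap_iSup, MeasurableSpace.comap_comp]
  exact iSup₂_le fun s hs => measurable_iff_comap_le.1 (measurable_extend_eval φ hφ R hs)

/-- A function of a Markov process and of an additive functional of its jumps is a Markov process
as soon as the generators are intertwined along almost every path. -/
theorem isMarkovLaw_map_extend {S' : Type*} (hL : IsBoundedOp L B) {x₀ : S}
    {μ : Measure (CadlagPath S)} (hμ : IsMarkovLaw L x₀ μ) (φ : S → S → A) (hφ : ∀ x, φ x x = 0)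
    (R : S → A → S') {L' : (S' → ℝ) → S' → ℝ} {B' : ℝ} (hL' : IsBoundedOp L' B') {x₀' : S'}
    (hx₀ : R x₀ 0 = x₀') (G : S → A → Prop) (hG : ∀ᵐ ω ∂μ, ∀ t, G (ω t) (jumpSum φ ω t))
    (hGL : ∀ x u, G x u → ∀ f : S' → ℝ, L (fun y => f (R y (u + φ x y))) x = L' f (R x u)) :
    IsMarkovLaw L' x₀' (μ.map (extend φ hφ R)) := by
  have := hμ.isProb
  have hΨ := measurable_extend φ hφ R
  have hprob : IsProbabilityMeasure (μ.map (extend φ hφ R)) :=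
    Measure.isProbabilityMeasure_map hΨ.aemeasurable
  refine ⟨hprob, ?_, ?_⟩
  · have hm : MeasurableSet {ω : CadlagPath S' | ω 0 = x₀'} := by
      have h : Measurable[_, ⊤] fun ω : CadlagPath S' => ω 0 :=
        @Measurable.mono _ _ _ _ ⊤ ⊤ _ (@measurable_eval _ _ ⊤ id 0 0 le_rfl)
          ((canonicalFiltration S').le 0) le_rfl
      exact h (show MeasurableSet[⊤] {x₀'} from trivial)
    rw [ae_map_iff hΨ.aemeasurable hm]
    filter_upwards [hμ.initial] with ω hω
    rw [extend_apply, jumpSum_zero, hω, hx₀]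
  · rintro f ⟨C, hf⟩
    have hmeas : ∀ t, Measurable[canonicalFiltration S' t] (increment L' f 0 t) := fun t =>
      measurable_increment hL' hf zero_le
    have hint : ∀ t, Integrable (increment L' f 0 t) (μ.map (extend φ hφ R)) := fun t =>
      Integrable.of_bound ((hmeas t).mono ((canonicalFiltration S').le t)
        le_rfl).aestronglyMeasurable _
        (Eventually.of_forall fun ω => abs_increment_le hL' hf zero_le ω)
    refine ⟨fun t => (hmeas t).stronglyMeasurable, fun s t hst => ?_⟩
    refine (ae_eq_condExp_of_forall_setIntegral_eq ((canonicalFiltration S').le s) (hint t)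
      (fun _ _ _ => (hint s).integrableOn) (fun D hD _ => ?_)
      (hmeas s).stronglyMeasurable.aestronglyMeasurable).symm
    have hD' := (canonicalFiltration S').le s D hD
    refine (sub_eq_zero.1 ?_).symm
    change ∫ ω in D, increment L' f 0 t ω ∂_ - ∫ ω in D, increment L' f 0 s ω ∂_ = 0
    rw [← integral_sub (hint t).integrableOn (hint s).integrableOn]
    simp_rw [increment_sub hL' hf s t]
    rw [setIntegral_map hD' (((measurable_increment hL' hf hst).mono ((canonicalFiltration S').le t)
        le_rfl).aestronglyMeasurable) hΨ.aemeasurable]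
    -- The target `0` is replaced by the mean of the martingale increment of the pair; the two
    -- integrands then agree almost surely by the intertwining relation.
    rw [← setIntegral_jumpSum hL hμ φ hφ (F := fun x u => f (R x u)) (fun x u => hf _) hst
      (measurable_extend_canonical φ hφ R s hD)]
    refine integral_congr_ae (ae_restrict_of_ae ?_)
    filter_upwards [hG] with ω hω
    simp only [increment, extend_apply]
    congr 1
    refine intervalIntegral.integral_congr fun v _ => ?_
    exact (hGL _ _ (hω _) f).symm

/-- By right continuity it is enough to impose the condition at a countable dense set of times. -/
theorem measurableSet_forall (φ : S → S → A) (hφ : ∀ x, φ x x = 0) (G : S → A → Prop) :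
    MeasurableSet {ω : CadlagPath S | ∀ t, G (ω t) (jumpSum φ ω t)} := by
  obtain ⟨Q, hQc, hQd⟩ := TopologicalSpace.exists_countable_dense ℝ≥0
  have h : {ω : CadlagPath S | ∀ t, G (ω t) (jumpSum φ ω t)} =
      ⋂ q ∈ Q, {ω : CadlagPath S | G (ω q) (jumpSum φ ω q)} := by
    ext ω
    simp only [Set.mem_iInter]
    refine ⟨fun hω q _ => hω q, fun hω t => ?_⟩
    obtain ⟨b, hb, hsub⟩ := (mem_nhdsGT_iff_exists_Ioo_subset' (lt_add_one t)).1
      ((ω.right_cont t).and (eventually_jumpSum_right φ hφ ω t))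
    obtain ⟨q, hq, hqI⟩ := hQd.exists_mem_open isOpen_Ioo (Set.nonempty_Ioo.2 hb)
    have h1 := hω q hq
    obtain ⟨h2, h3⟩ := hsub hqI
    change G (ω q) (jumpSum φ ω q) at h1
    rwa [h2, h3] at h1
  rw [h]
  refine MeasurableSet.biInter hQc fun q _ => ?_
  have h1 := (measurable_extend_eval φ hφ (fun x u => G x u) (le_refl q)).mono
    ((canonicalFiltration S).le q) le_rfl
  have h2 := h1 (show MeasurableSet[⊤] {True} from trivial)
  convert h2 using 1
  ext ω
  simp [extend_apply]

end CadlagPath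

end FepSwt

/-! ### Enumerations of the particles on the integers -/

namespace FepSwt

/-- The enumeration obtained from `X` when the particles of label `j` modulo `K` move by `e`. -/
def moveLabel (K : ℕ) (j e : ℤ) (X : ℤ → ℤ) : ℤ → ℤ :=
  fun k => if (K : ℤ) ∣ k - j then X k + e else X k

variable {N K : ℕ} [NeZero N]

theorem Conf.ext {η η' : Conf N K} (h : ∀ x : ℤ, η.1 (x : ZMod N) = η'.1 (x : ZMod N)) :
    η = η' :=
  Subtype.ext (funext fun x => by
    obtain ⟨y, rfl⟩ := ZMod.intCast_surjective x
    exact h y)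

namespace IsEnum

variable {η η' : Conf N K} {X X' : ℤ → ℤ}

theorem periodic_mul (hX : IsEnum η X) (k q : ℤ) : X (k + K * q) = X k + N * q := by
  induction q using Int.induction_on with
  | zero => simp
  | succ i ih =>
    rw [mul_add, mul_one, ← add_assoc, hX.periodic, ih]; ring
  | pred i ih =>
    have h := hX.periodic (k + K * (-(i : ℤ) - 1))
    rw [show k + K * (-(i : ℤ) - 1) + K = k + K * (-(i : ℤ)) by ring, ih] at h
    linarith

theorem occ_apply (hX : IsEnum η X) (k : ℤ) : η.1 (X k : ZMod N) = true :=
  (hX.mem_iff _).2 ⟨k, rfl⟩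

theorem cast_eq_iff (hX : IsEnum η X) (k j : ℤ) :
    (X k : ZMod N) = (X j : ZMod N) ↔ (K : ℤ) ∣ k - j := by
  rw [ZMod.intCast_eq_intCast_iff_dvd_sub]
  constructor
  · rintro ⟨q, hq⟩
    have h : X j = X (k + K * q) := by rw [hX.periodic_mul]; linarith
    have := hX.mono.injective h
    exact ⟨-q, by linarith⟩
  · rintro ⟨q, hq⟩
    have h := hX.periodic_mul j q
    rw [show j + K * q = k by linarith] at h
    exact ⟨-q, by rw [h]; ring⟩

theorem shift (hX : IsEnum η X) (m : ℤ) : IsEnum η fun k => X (k + m) where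
  mono a b h := hX.mono (by linarith)
  periodic k := by
    rw [show k + K + m = (k + m) + K by ring]; exact hX.periodic _
  mem_iff x := by
    rw [hX.mem_iff]
    exact ⟨fun ⟨k, hk⟩ => ⟨k - m, by simpa using hk⟩, fun ⟨k, hk⟩ => ⟨k + m, hk⟩⟩

theorem conf_eq (hX : IsEnum η X) (hX' : IsEnum η' X) : η = η' :=
  Conf.ext fun x => by
    rw [Bool.eq_iff_iff, hX.mem_iff, hX'.mem_iff]

/-- Two strictly increasing listings of the same set of integers agree from any common point in both
directions, so they differ by a translation of the index. -/
theorem unique (hX : IsEnum η X) (hX' : IsEnum η X') : ∃ m : ℤ, ∀ k, X' k = X (k + m) := by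
  have hsub : ∀ {X X' : ℤ → ℤ}, IsEnum η X → IsEnum η X' → ∀ k, ∃ l, X l = X' k :=
    fun h h' k => (h.mem_iff _).1 (h'.occ_apply k)
  have hnext : ∀ k l, X' k = X l → X' (k + 1) = X (l + 1) := by
    intro k l hkl
    obtain ⟨a, ha⟩ := hsub hX hX' (k + 1)
    obtain ⟨b, hb⟩ := hsub hX' hX (l + 1)
    have h1 : l < a := hX.mono.lt_iff_lt.1 (by rw [← hkl, ha]; exact hX'.mono (lt_add_one k))
    have h2 : k < b := hX'.mono.lt_iff_lt.1 (by rw [hkl, hb]; exact hX.mono (lt_add_one l))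
    have h3 := hX.mono.monotone (show l + 1 ≤ a from h1)
    have h4 := hX'.mono.monotone (show k + 1 ≤ b from h2)
    omega
  have hprev : ∀ k l, X' k = X l → X' (k - 1) = X (l - 1) := by
    intro k l hkl
    obtain ⟨a, ha⟩ := hsub hX hX' (k - 1)
    obtain ⟨b, hb⟩ := hsub hX' hX (l - 1)
    have h1 : a < l := hX.mono.lt_iff_lt.1 (by rw [← hkl, ha]; exact hX'.mono (sub_one_lt k))
    have h2 : b < k := hX'.mono.lt_iff_lt.1 (by rw [hkl, hb]; exact hX.mono (sub_one_lt l))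
    have h3 := hX.mono.monotone (show a ≤ l - 1 by omega)
    have h4 := hX'.mono.monotone (show b ≤ k - 1 by omega)
    omega
  obtain ⟨m, hm⟩ := hsub hX hX' 0
  refine ⟨m, fun k => ?_⟩
  induction k using Int.induction_on with
  | zero => rw [zero_add, hm]
  | succ i ih => rw [hnext _ _ ih]; congr 1; ring
  | pred i ih => rw [hprev _ _ ih]; congr 1; ring

theorem unique_first (hX : IsEnum η X) (hX' : IsEnum η X') (h : IsFirst X) (h' : IsFirst X') :
    X = X' := by
  obtain ⟨m, hm⟩ := hX.unique hX'
  have h0 := hm 0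
  have h1 := hm 1
  have h2 : 0 + m < 1 := hX.mono.lt_iff_lt.1 (by rw [← h0]; exact h'.1.trans_le h.2)
  have h3 : 0 < 1 + m := hX.mono.lt_iff_lt.1 (by rw [← h1]; exact h.1.trans_le h'.2)
  obtain rfl : m = 0 := by omega
  funext k
  rw [hm, add_zero]

/-- A shift by one telescopes over a period to `X (i + K) - X i = N`. Compared with `sum_moveLabel`,
this invariant distinguishes a relabelling from a motion. -/
theorem sum_shift (hX : IsEnum η X) (m : ℤ) :
    ∑ i ∈ Finset.range K, (X (i + m) - X i) = m * N := by
  have hstep : ∀ m : ℤ, ∑ i ∈ Finset.range K, (X (i + (m + 1)) - X (i + m)) = N := by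
    intro m
    have h := Finset.sum_range_sub (fun i : ℕ => X (i + m)) K
    simp only [Nat.cast_zero, zero_add] at h
    rw [add_comm (K : ℤ) m, hX.periodic, add_sub_cancel_left] at h
    rw [← h]
    refine Finset.sum_congr rfl fun i _ => ?_
    push_cast
    rw [add_right_comm, add_assoc]
  induction m using Int.induction_on with
  | zero => simp
  | succ i ih =>
    have h := hstep i
    rw [add_mul, one_mul, ← ih, ← h, ← Finset.sum_add_distrib]
    exact Finset.sum_congr rfl fun _ _ => by ring
  | pred i ih =>
    have h := hstep (-(i : ℤ) - 1)
    rw [sub_mul, one_mul, ← ih]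
    nth_rewrite 1 [← h]
    rw [← Finset.sum_sub_distrib]
    refine Finset.sum_congr rfl fun l _ => ?_
    rw [show -(i : ℤ) - 1 + 1 = -i by ring]
    ring

theorem sum_moveLabel [NeZero K] (X : ℤ → ℤ) (j e : ℤ) :
    ∑ i ∈ Finset.range K, (moveLabel K j e X i - X i) = e := by
  have hK : (0 : ℤ) < K := by exact_mod_cast Nat.pos_of_ne_zero (NeZero.ne K)
  have h0 := Int.emod_nonneg j hK.ne'
  have h1 := Int.emod_lt_of_pos j hK
  rw [Finset.sum_eq_single_of_mem (j % K).toNat (by rw [Finset.mem_range]; omega)]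
  · have : (K : ℤ) ∣ ((j % K).toNat : ℤ) - j := by
      rw [Int.toNat_of_nonneg h0]
      exact ⟨-(j / K), by have := Int.mul_ediv_add_emod j K; linarith⟩
    rw [moveLabel, if_pos this, add_sub_cancel_left]
  · intro i hi hne
    have : ¬ (K : ℤ) ∣ (i : ℤ) - j := by
      intro hd
      have h2 := (Int.emod_eq_emod_iff_emod_sub_eq_zero).2 (Int.emod_eq_zero_of_dvd hd)
      rw [Int.emod_eq_of_lt (by omega) (by have := Finset.mem_range.1 hi; omega)] at h2
      omega
    simp [moveLabel, this]

/-- The order of the particles survives because the target site is empty: a neighbour reached by the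
moving particle would occupy that site. -/
theorem isEnum_moveLabel (hX : IsEnum η X) {j e : ℤ} (he : e = 1 ∨ e = -1)
    (hempty : η.1 ((X j + e : ℤ) : ZMod N) = false)
    (hη' : ∀ y, η'.1 y = η.1 (Equiv.swap (X j : ZMod N) ((X j + e : ℤ) : ZMod N) y)) :
    IsEnum η' (moveLabel K j e X) := by
  have hfree : ∀ k, (K : ℤ) ∣ k - j → ∀ l, X l ≠ X k + e := by
    intro k hk l hl
    have h1 := hX.occ_apply l
    rw [hl, Int.cast_add, (hX.cast_eq_iff k j).2 hk, ← Int.cast_add, hempty] at h1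
    exact Bool.false_ne_true h1
  refine ⟨strictMono_int_of_lt_succ fun k => ?_, fun k => ?_, fun x => ?_⟩
  · have h := hX.mono (lt_add_one k)
    simp only [moveLabel]
    split_ifs with h1 h2 h2
    · omega
    · rcases he with rfl | rfl
      · have := hfree k h1 (k + 1)
        omega
      · omega
    · rcases he with rfl | rfl
      · omega
      · have := hfree (k + 1) h2 k
        omega
    · exact h
  · have : (K : ℤ) ∣ k + K - j ↔ (K : ℤ) ∣ k - j := by
      rw [show k + K - j = (k - j) + K by ring]
      exact dvd_add_self_right
    simp only [moveLabel, this, hX.periodic]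
    split_ifs
    · ring
    · rfl
  · rw [hη']
    have hne : ((X j + e : ℤ) : ZMod N) ≠ (X j : ZMod N) := fun h => by
      rw [h, hX.occ_apply] at hempty
      exact Bool.noConfusion hempty
    have hmove : ∀ k, (K : ℤ) ∣ k - j → ((X k + e : ℤ) : ZMod N) = ((X j + e : ℤ) : ZMod N) :=
      fun k hk => by rw [Int.cast_add, (hX.cast_eq_iff k j).2 hk, ← Int.cast_add]
    by_cases hx : (x : ZMod N) = ((X j + e : ℤ) : ZMod N)
    · rw [hx, Equiv.swap_apply_right]
      refine iff_of_true (hX.occ_apply j) ?_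
      have h1 : ((x - e : ℤ) : ZMod N) = (X j : ZMod N) := by
        rw [Int.cast_sub, hx, Int.cast_add, add_sub_cancel_right]
      obtain ⟨k, hk⟩ := (hX.mem_iff (x - e)).1 (h1 ▸ hX.occ_apply j)
      have hkj : (K : ℤ) ∣ k - j := (hX.cast_eq_iff k j).1 (hk ▸ h1)
      exact ⟨k, by simp only [moveLabel, hkj, if_true]; omega⟩
    · by_cases hx' : (x : ZMod N) = (X j : ZMod N)
      · rw [hx', Equiv.swap_apply_left]
        refine iff_of_false (by rw [hempty]; exact Bool.false_ne_true) ?_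
        rintro ⟨k, hk⟩
        simp only [moveLabel] at hk
        split_ifs at hk with h
        · exact hx (by rw [← hk, hmove k h])
        · exact h ((hX.cast_eq_iff k j).1 (by rw [hk, hx']))
      · rw [Equiv.swap_apply_of_ne_of_ne hx' hx, hX.mem_iff]
        refine exists_congr fun k => ?_
        simp only [moveLabel]
        split_ifs with h
        · refine iff_of_false (fun hk => hx' ?_) (fun hk => hx ?_)
          · rw [← hk, (hX.cast_eq_iff k j).2 h]
          · rw [← hk, hmove k h]
        · rfl

end IsEnum

theorem exists_isEnum [NeZero K] (η : Conf N K) : ∃ X, IsEnum η X ∧ IsFirst X := by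
  classical
  have hN : (0 : ℤ) < N := by exact_mod_cast Nat.pos_of_ne_zero (NeZero.ne N)
  have hK : (0 : ℤ) < K := by exact_mod_cast Nat.pos_of_ne_zero (NeZero.ne K)
  let P : Finset ℕ := (Finset.range N).filter fun i => η.1 (i : ZMod N) = true
  have hP : P.card = K := by
    refine Eq.trans ?_ η.2
    refine Finset.card_nbij' (fun i => (i : ZMod N)) ZMod.val ?_ ?_ ?_ ?_
    · intro i hi
      simpa using (Finset.mem_filter.1 hi).2
    · intro x hx
      have hx' : η.1 x = true := by simpa using hx
      simp [P, hx', ZMod.val_lt]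
    · intro i hi
      exact ZMod.val_cast_of_lt (Finset.mem_range.1 (Finset.mem_filter.1 hi).1)
    · intro x _
      simp
  let e := P.orderEmbOfFin hP
  have he : ∀ r, e r < N ∧ η.1 ((e r : ℕ) : ZMod N) = true := fun r => by
    have := Finset.mem_filter.1 (P.orderEmbOfFin_mem hP r)
    exact ⟨Finset.mem_range.1 this.1, this.2⟩
  -- The particles in `[0, N)` are repeated with period `N`. Dividing `k - 1` rather than `k` gives
  -- label `1` to the first of them and label `0` to the last one translated by `-N`, which is
  -- negative.
  let X : ℤ → ℤ := fun k => N * ((k - 1) / K) +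
    e ⟨((k - 1) % K).toNat, by
      have := Int.emod_nonneg (k - 1) hK.ne'
      have := Int.emod_lt_of_pos (k - 1) hK
      omega⟩
  have hXe : ∀ (q : ℤ) (r : Fin K), X (1 + K * q + r) = N * q + e r := by
    intro q r
    have hr : ((r : ℕ) : ℤ) < K := by exact_mod_cast r.2
    have h1 : (1 + K * q + (r : ℕ) - 1 : ℤ) = r + K * q := by ring
    have h2 : ((r : ℕ) + K * q : ℤ) / K = q := by
      rw [Int.add_mul_ediv_left _ _ hK.ne', Int.ediv_eq_zero_of_lt (by omega) hr, zero_add]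
    have h3 : ((r : ℕ) + K * q : ℤ) % K = r := by
      rw [Int.add_mul_emod_self_left, Int.emod_eq_of_lt (by omega) hr]
    simp only [X, h1, h2, h3, Int.toNat_natCast]
  have hdec : ∀ k : ℤ, ∃ (q : ℤ) (r : Fin K), k = 1 + K * q + (r : ℕ) := by
    intro k
    have h0 := Int.emod_nonneg (k - 1) hK.ne'
    have h1 := Int.emod_lt_of_pos (k - 1) hK
    refine ⟨(k - 1) / K, ⟨((k - 1) % K).toNat, by omega⟩, ?_⟩
    have := Int.mul_ediv_add_emod (k - 1) K
    simp only [Int.toNat_of_nonneg h0]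
    linarith
  have hKpos : 0 < K := Nat.pos_of_ne_zero (NeZero.ne K)
  refine ⟨X, ⟨strictMono_int_of_lt_succ fun k => ?_, fun k => ?_, fun x => ?_⟩, ?_, ?_⟩
  · obtain ⟨q, r, rfl⟩ := hdec k
    by_cases hr : (r : ℕ) + 1 < K
    · have h1 : (1 + K * q + (r : ℕ) + 1 : ℤ) = 1 + K * q + ((⟨r + 1, hr⟩ : Fin K) : ℕ) := by
        push_cast; ring
      rw [h1, hXe, hXe]
      have : e r < e ⟨r + 1, hr⟩ := e.strictMono (by rw [Fin.lt_def]; simp)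
      omega
    · have h0 : (r : ℕ) + 1 = K := by have := r.2; omega
      have h1 : (1 + K * q + (r : ℕ) + 1 : ℤ) = 1 + K * (q + 1) + ((⟨0, hKpos⟩ : Fin K) : ℕ) := by
        have : ((r : ℕ) : ℤ) + 1 = K := by exact_mod_cast h0
        push_cast; linarith
      rw [h1, hXe, hXe]
      have h2 := (he r).1
      have : (N : ℤ) * (q + 1) = N * q + N := by ring
      omega
  · obtain ⟨q, r, rfl⟩ := hdec k
    rw [show (1 + K * q + (r : ℕ) + K : ℤ) = 1 + K * (q + 1) + (r : ℕ) by ring, hXe, hXe]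
    ring
  · constructor
    · intro hx
      have h0 := Int.emod_nonneg x hN.ne'
      have h1 := Int.emod_lt_of_pos x hN
      have hcast : (((x % N).toNat : ℕ) : ZMod N) = (x : ZMod N) := by
        rw [← Int.cast_natCast, Int.toNat_of_nonneg h0]
        simp
      have hmem : (x % N).toNat ∈ P := by
        simp only [P, Finset.mem_filter, Finset.mem_range, hcast, hx, and_true]
        omega
      have hrange : (x % N).toNat ∈ Set.range e := by
        rw [Finset.range_orderEmbOfFin]; exact hmem
      obtain ⟨r, hr⟩ := hrange
      refine ⟨1 + K * (x / N) + (r : ℕ), ?_⟩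
      rw [hXe, hr, Int.toNat_of_nonneg h0]
      exact Int.mul_ediv_add_emod x N
    · rintro ⟨k, rfl⟩
      obtain ⟨q, r, rfl⟩ := hdec k
      rw [hXe]
      simpa using (he r).2
  · have h1 : (0 : ℤ) = 1 + K * (-1) + ((⟨K - 1, by omega⟩ : Fin K) : ℕ) := by
      simp only []
      omega
    rw [h1, hXe]
    have := (he ⟨K - 1, by omega⟩).1
    omega
  · have h1 : (1 : ℤ) = 1 + K * 0 + ((⟨0, hKpos⟩ : Fin K) : ℕ) := by simp
    rw [h1, hXe]
    simp

end FepSwt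

/-! ### Gaps, their conserved sum, and the frozen, ergodic and transient sets -/

namespace FepSwt

/-- `ξ` is the SWT configuration given by the gaps between the consecutive positions `X`. -/
def IsGaps {K : ℕ} (ξ : Gam K) (X : ℤ → ℤ) : Prop :=
  ∀ k : ℤ, ξ.1 (k : ZMod K) = 2 + X k - X (k + 1)

theorem IsGaps.eq {K : ℕ} {ξ ξ' : Gam K} {X : ℤ → ℤ} (h : IsGaps ξ X) (h' : IsGaps ξ' X) :
    ξ = ξ' :=
  Subtype.ext (funext fun k => by
    obtain ⟨k, rfl⟩ := ZMod.intCast_surjective k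
    rw [h, h'])

theorem intCast_eq_iff_dvd {K : ℕ} (a b : ℤ) : (a : ZMod K) = (b : ZMod K) ↔ (K : ℤ) ∣ a - b := by
  rw [eq_comm, ZMod.intCast_eq_intCast_iff_dvd_sub]

/-- The effect on the gaps of a move of the particles of label `j` by `e`. -/
theorem IsGaps.moveLabel_iff {K : ℕ} {ξ ξ' : Gam K} {X : ℤ → ℤ} (h : IsGaps ξ X) (j e : ℤ) :
    IsGaps ξ' (moveLabel K j e X) ↔ ∀ i : ZMod K, ξ'.1 i =
      ξ.1 i + (if i = (j : ZMod K) then e else 0) - if i + 1 = (j : ZMod K) then e else 0 := by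
  have key : ∀ i : ℤ, 2 + moveLabel K j e X i - moveLabel K j e X (i + 1) =
      ξ.1 i + (if (i : ZMod K) = (j : ZMod K) then e else 0) -
        if (i : ZMod K) + 1 = (j : ZMod K) then e else 0 := by
    intro i
    have e1 : (i : ZMod K) + 1 = ((i + 1 : ℤ) : ZMod K) := by push_cast; rfl
    rw [h i, e1]
    simp only [moveLabel, intCast_eq_iff_dvd]
    split_ifs <;> ring
  constructor
  · intro h' i
    obtain ⟨i, rfl⟩ := ZMod.intCast_surjective i
    rw [h' i, key]
  · intro h' i
    rw [h', key]

variable {N K : ℕ} [NeZero N]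

/-- The gaps of an enumeration. -/
def IsEnum.gaps {η : Conf N K} {X : ℤ → ℤ} (hX : IsEnum η X) : Gam K :=
  ⟨fun k => 2 + X k.cast - X (k.cast + 1), fun k => by
    have := hX.mono (lt_add_one (k.cast : ℤ))
    dsimp only
    omega⟩

theorem IsEnum.isGaps {η : Conf N K} {X : ℤ → ℤ} (hX : IsEnum η X) : IsGaps hX.gaps X := by
  intro k
  have h : (((k : ZMod K).cast : ℤ) : ZMod K) = (k : ZMod K) := ZMod.intCast_zmod_cast _
  obtain ⟨q, hq⟩ := (intCast_eq_iff_dvd _ _).1 h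
  have h1 := hX.periodic_mul k q
  have h2 := hX.periodic_mul (k + 1) q
  rw [show k + K * q = (k : ZMod K).cast by linarith] at h1
  rw [show k + 1 + K * q = (k : ZMod K).cast + 1 by linarith] at h2
  simp only [IsEnum.gaps, h1, h2]
  ring

namespace IsEnum

variable {η : Conf N K} {X : ℤ → ℤ} {ξ : Gam K}

theorem occ_add_one_iff (hX : IsEnum η X) (j : ℤ) :
    η.1 ((X j + 1 : ℤ) : ZMod N) = true ↔ X (j + 1) = X j + 1 := by
  rw [hX.mem_iff]
  refine ⟨fun ⟨l, hl⟩ => ?_, fun h => ⟨_, h⟩⟩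
  have h1 : j < l := hX.mono.lt_iff_lt.1 (by omega)
  have h2 := hX.mono.monotone (show j + 1 ≤ l from h1)
  have h3 := hX.mono (lt_add_one j)
  omega

theorem occ_sub_one_iff (hX : IsEnum η X) (j : ℤ) :
    η.1 ((X j - 1 : ℤ) : ZMod N) = true ↔ X (j - 1) = X j - 1 := by
  rw [hX.mem_iff]
  refine ⟨fun ⟨l, hl⟩ => ?_, fun h => ⟨_, h⟩⟩
  have h1 : l < j := hX.mono.lt_iff_lt.1 (by omega)
  have h2 := hX.mono.monotone (show l ≤ j - 1 by omega)
  have h3 := hX.mono (sub_one_lt j)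
  omega

theorem exists_between (hX : IsEnum η X) (x : ℤ) : ∃ k, X k ≤ x ∧ x < X (k + 1) := by
  have hN : (1 : ℤ) ≤ N := by exact_mod_cast NeZero.one_le
  have hlow := hX.periodic_mul 0 (-|x - X 0|)
  -- Since `N ≥ 1`, going back `|x - X 0|` periods from label `0` certainly lands at or to the left
  -- of `x`.
  have hne : ∃ k, X k ≤ x := by
    refine ⟨_, hlow.trans_le ?_⟩
    nlinarith [abs_nonneg (x - X 0), neg_abs_le (x - X 0)]
  have hup := hX.periodic_mul 0 (|x - X 0| + 1)
  have hbd : ∃ b, ∀ k, X k ≤ x → k ≤ b := by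
    refine ⟨0 + K * (|x - X 0| + 1), fun k hk => hX.mono.le_iff_le.1 (hk.trans ?_)⟩
    rw [hup]
    nlinarith [abs_nonneg (x - X 0), le_abs_self (x - X 0)]
  obtain ⟨k, hk, hmax⟩ := Int.exists_greatest_of_bdd hbd hne
  refine ⟨k, hk, not_le.1 fun h => ?_⟩
  have := hmax _ h
  omega

theorem gap_eq_one_iff (hX : IsEnum η X) (hξ : IsGaps ξ X) (k : ℤ) :
    ξ.1 k = 1 ↔ η.1 ((X k + 1 : ℤ) : ZMod N) = true := by
  rw [hX.occ_add_one_iff, hξ k]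
  omega

theorem gap_nonpos_iff (hX : IsEnum η X) (hξ : IsGaps ξ X) (k : ℤ) :
    ξ.1 k ≤ 0 ↔ η.1 ((X k + 1 : ℤ) : ZMod N) = false := by
  rw [← Bool.not_eq_true, ← hX.gap_eq_one_iff hξ]
  have := ξ.2 (k : ZMod K)
  omega

theorem gap_pred_eq_one_iff (hX : IsEnum η X) (hξ : IsGaps ξ X) (k : ℤ) :
    ξ.1 ((k - 1 : ℤ) : ZMod K) = 1 ↔ η.1 ((X k - 1 : ℤ) : ZMod N) = true := by
  rw [hX.occ_sub_one_iff, hξ, sub_add_cancel]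
  omega

theorem gap_pred_nonpos_iff (hX : IsEnum η X) (hξ : IsGaps ξ X) (k : ℤ) :
    ξ.1 ((k - 1 : ℤ) : ZMod K) ≤ 0 ↔ η.1 ((X k - 1 : ℤ) : ZMod N) = false := by
  rw [← Bool.not_eq_true, ← hX.gap_pred_eq_one_iff hξ]
  have := ξ.2 ((k - 1 : ℤ) : ZMod K)
  omega

theorem mem_fepFrozen_iff (hX : IsEnum η X) (hξ : IsGaps ξ X) :
    η ∈ fepFrozen N K ↔ ξ ∈ swtFrozen K := by
  constructor
  · intro h k
    obtain ⟨k, rfl⟩ := ZMod.intCast_surjective k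
    rw [hX.gap_nonpos_iff hξ]
    have h1 := h (X k : ZMod N)
    simpa [Conf.occ, hX.occ_apply k] using h1
  · intro h x
    by_cases hx : η.1 x = true
    · obtain ⟨x, rfl⟩ := ZMod.intCast_surjective x
      obtain ⟨k, rfl⟩ := (hX.mem_iff x).1 hx
      have h1 := (hX.gap_nonpos_iff hξ k).1 (h k)
      push_cast at h1
      simp [Conf.occ, h1]
    · simp [Conf.occ, hx]

/-- A gap is nonnegative exactly when at most one hole separates the two particles. Conversely, two
adjacent holes lie strictly between two consecutive particles, whose gap is then negative. -/
theorem mem_fepErgodic_iff (hX : IsEnum η X) (hξ : IsGaps ξ X) :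
    η ∈ fepErgodic N K ↔ ξ ∈ swtErgodic K := by
  constructor
  · intro h k
    obtain ⟨k, rfl⟩ := ZMod.intCast_surjective k
    by_contra hneg
    rw [hξ k] at hneg
    have hempty : ∀ x, X k < x → x < X (k + 1) → ¬ η.1 (x : ZMod N) = true := by
      intro x h1 h2 h3
      obtain ⟨l, rfl⟩ := (hX.mem_iff x).1 h3
      have := hX.mono.lt_iff_lt.1 h1
      have := hX.mono.lt_iff_lt.1 h2
      omega
    have h1 := hempty (X k + 1) (by omega) (by omega)
    have h2 := hempty (X k + 1 + 1) (by omega) (by omega)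
    have h3 := h ((X k + 1 : ℤ) : ZMod N)
    rw [Int.cast_add _ (1 : ℤ), Int.cast_one] at h2
    simp only [Conf.occ, h1, h2] at h3
    norm_num at h3
  · intro h x
    obtain ⟨x, rfl⟩ := ZMod.intCast_surjective x
    by_contra hne
    rw [mul_eq_zero, not_or] at hne
    have h1 : ¬ η.1 (x : ZMod N) = true := fun h' => hne.1 (by simp [Conf.occ, h'])
    have h2 : ¬ η.1 ((x + 1 : ℤ) : ZMod N) = true := fun h' =>
      hne.2 (by push_cast at h'; simp [Conf.occ, h'])
    obtain ⟨k, hk, hk'⟩ := hX.exists_between x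
    have h3 : X k ≠ x := fun h' => h1 ((hX.mem_iff x).2 ⟨k, h'⟩)
    have h4 : X (k + 1) ≠ x + 1 := fun h' => h2 ((hX.mem_iff _).2 ⟨_, h'⟩)
    have h5 := h (k : ZMod K)
    rw [hξ k] at h5
    omega

variable [NeZero K]

theorem sum_gaps (hX : IsEnum η X) (hξ : IsGaps ξ X) : ∑ k, ξ.1 k = 2 * K - N := by
  have h1 : ∑ i ∈ Finset.range K, ξ.1 ((i : ℤ) : ZMod K) = ∑ k, ξ.1 k := by
    refine Finset.sum_nbij' (fun i => ((i : ℤ) : ZMod K)) ZMod.val (fun _ _ => Finset.mem_univ _)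
      (fun k _ => Finset.mem_range.2 (ZMod.val_lt k)) (fun i hi => ?_) (fun k _ => ?_)
      (fun _ _ => rfl)
    · simpa using ZMod.val_cast_of_lt (Finset.mem_range.1 hi)
    · simp
  rw [← h1]
  have h2 := Finset.sum_range_sub (fun i : ℕ => X i) K
  have h3 := hX.periodic 0
  simp only [Nat.cast_zero] at h2
  rw [zero_add] at h3
  have h4 : ∀ i : ℕ, ξ.1 ((i : ℤ) : ZMod K) = 2 - (X ((i + 1 : ℕ) : ℤ) - X i) := by
    intro i
    rw [hξ]
    push_cast
    ring
  simp only [h4, Finset.sum_sub_distrib, Finset.sum_const, Finset.card_range] at h2 ⊢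
  rw [nsmul_eq_mul]
  linarith

end IsEnum

theorem trapDepth_pos_iff [NeZero K] (ξ : Gam K) : 0 < trapDepth ξ ↔ ξ ∉ swtErgodic K := by
  have h0 : ∀ k ∈ (Finset.univ : Finset (ZMod K)), 0 ≤ -min (ξ.1 k) 0 := fun k _ => by
    have := min_le_right (ξ.1 k) 0
    omega
  rw [trapDepth, ← Finset.sum_neg_distrib, Finset.sum_pos_iff_of_nonneg h0]
  simp only [swtErgodic, Set.mem_ofPred_eq, not_forall, Finset.mem_univ, true_and]
  refine exists_congr fun k => ?_
  omega

theorem swtParticles_pos_iff [NeZero K] (ξ : Gam K) : 0 < swtParticles ξ ↔ ξ ∉ swtFrozen K := by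
  have h0 : ∀ k ∈ (Finset.univ : Finset (ZMod K)), (0 : ℤ) ≤ if ξ.1 k = 1 then 1 else 0 :=
    fun k _ => by split_ifs <;> norm_num
  rw [swtParticles, Finset.sum_pos_iff_of_nonneg h0]
  simp only [swtFrozen, Set.mem_ofPred_eq, not_forall, Finset.mem_univ, true_and]
  refine exists_congr fun k => ?_
  have := ξ.2 k
  split_ifs <;> omega

/-- The sign of `∑ ξ_k = 2K - N` decides the regime. If it is `≤ 0`, an ergodic `ξ` vanishes
identically and is frozen; if it is `≥ 0`, a frozen `ξ` vanishes and is ergodic. In either regime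
"transient" therefore amounts to "neither frozen nor ergodic". -/
theorem IsEnum.mem_fepTransient_iff [NeZero K] {η : Conf N K} {X : ℤ → ℤ} {ξ : Gam K}
    (hX : IsEnum η X) (hξ : IsGaps ξ X) : η ∈ fepTransient N K ↔ ξ ∈ swtTransient K := by
  have hsum := hX.sum_gaps hξ
  have hc1 : (K : ℝ) ≤ N / 2 ↔ (2 * K - N : ℤ) ≤ 0 := by
    rw [le_div_iff₀ two_pos, sub_nonpos, mul_comm]
    exact_mod_cast Iff.rfl
  have hc2 : (N : ℝ) / 2 ≤ K ↔ (0 : ℤ) ≤ 2 * K - N := by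
    rw [div_le_iff₀ two_pos, sub_nonneg, mul_comm]
    exact_mod_cast Iff.rfl
  have e1 : (2 * K - N : ℤ) ≤ 0 → ξ ∈ swtErgodic K → ξ ∈ swtFrozen K := by
    intro h1 h2
    have h3 : ∑ k, ξ.1 k = 0 :=
      le_antisymm (hsum.trans_le h1) (Finset.sum_nonneg fun k _ => h2 k)
    intro k
    exact ((Finset.sum_eq_zero_iff_of_nonneg fun k _ => h2 k).1 h3 k (Finset.mem_univ k)).le
  have e2 : (0 : ℤ) ≤ 2 * K - N → ξ ∈ swtFrozen K → ξ ∈ swtErgodic K := by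
    intro h1 h2
    have h3 : ∑ k, ξ.1 k = 0 :=
      le_antisymm (Finset.sum_nonpos fun k _ => h2 k) (h1.trans_eq hsum.symm)
    intro k
    exact ((Finset.sum_eq_zero_iff_of_nonpos fun k _ => h2 k).1 h3 k (Finset.mem_univ k)).ge
  change (η ∉ fepFrozen N K ∧ _) ∨ (η ∉ fepErgodic N K ∧ _) ↔ 0 < trapDepth ξ ∧ 0 < swtParticles ξ
  rw [trapDepth_pos_iff, swtParticles_pos_iff, hX.mem_fepFrozen_iff hξ, hX.mem_fepErgodic_iff hξ,
    hc1, hc2]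
  rcases le_total (2 * K - N : ℤ) 0 with h | h
  · have := e1 h; tauto
  · have := e2 h; tauto

/-! ### The moves of the two processes -/

theorem Conf.swap_eq_exch (η : Conf N K) {x y : ZMod N} (h : y = x + 1) (z : ZMod N) :
    (η.exch x).1 z = η.1 (Equiv.swap x y z) := by
  rw [h]; rfl

namespace IsEnum

variable {η : Conf N K} {X : ℤ → ℤ} {ξ : Gam K}

theorem exch_right (hX : IsEnum η X) {j : ℤ} (h : η.1 ((X j + 1 : ℤ) : ZMod N) = false) :
    IsEnum (η.exch (X j : ZMod N)) (moveLabel K j 1 X) :=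
  hX.isEnum_moveLabel (Or.inl rfl) h fun y => η.swap_eq_exch (by push_cast; ring) y

theorem exch_left (hX : IsEnum η X) {j : ℤ} (h : η.1 ((X j - 1 : ℤ) : ZMod N) = false) :
    IsEnum (η.exch ((X j - 1 : ℤ) : ZMod N)) (moveLabel K j (-1) X) := by
  rw [sub_eq_add_neg] at h ⊢
  refine hX.isEnum_moveLabel (Or.inr rfl) h fun y => ?_
  rw [Equiv.swap_comm]
  exact η.swap_eq_exch (by push_cast; ring) y

/-- An exchange which changes the configuration involves one particle and one hole; which of the two
sites is occupied gives the direction of the move. -/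
theorem exists_moveLabel_exch (hX : IsEnum η X) {x : ZMod N} (hne : η.exch x ≠ η) :
    ∃ j e : ℤ, (e = 1 ∨ e = -1) ∧ IsEnum (η.exch x) (moveLabel K j e X) := by
  obtain ⟨x, rfl⟩ := ZMod.intCast_surjective x
  by_cases h1 : η.1 (x : ZMod N) = η.1 ((x + 1 : ℤ) : ZMod N)
  · refine absurd (Conf.ext fun y => ?_) hne
    change η.1 (Equiv.swap (x : ZMod N) ((x : ZMod N) + 1) y) = _
    have h2 : ((x + 1 : ℤ) : ZMod N) = (x : ZMod N) + 1 := by push_cast; ring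
    rw [h2] at h1
    rw [Equiv.swap_apply_def]
    split_ifs with h3 h4
    · rw [h3, h1]
    · rw [h4, h1]
    · rfl
  · by_cases h2 : η.1 (x : ZMod N) = true
    · obtain ⟨j, rfl⟩ := (hX.mem_iff x).1 h2
      rw [h2] at h1
      exact ⟨j, 1, Or.inl rfl, hX.exch_right (Bool.eq_false_iff.2 (Ne.symm h1))⟩
    · rw [Bool.not_eq_true] at h2
      rw [h2] at h1
      have h3 : η.1 ((x + 1 : ℤ) : ZMod N) = true := by
        simpa using Ne.symm h1
      obtain ⟨j, hj⟩ := (hX.mem_iff _).1 h3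
      obtain rfl : x = X j - 1 := by omega
      exact ⟨j, -1, Or.inr rfl, hX.exch_left h2⟩

theorem gaps_jump_right (hξ : IsGaps ξ X) {j : ℤ} (h1 : ξ.1 ((j - 1 : ℤ) : ZMod K) = 1)
    (h2 : ξ.1 (j : ZMod K) ≤ 0) :
    IsGaps (ξ.jump ((j - 1 : ℤ) : ZMod K) (j : ZMod K) h2) (moveLabel K j 1 X) := by
  rw [hξ.moveLabel_iff]
  intro i
  have e : i + 1 = (j : ZMod K) ↔ i = ((j - 1 : ℤ) : ZMod K) := by
    push_cast; exact eq_sub_iff_add_eq.symm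
  simp only [Gam.jump, e]
  split_ifs with h3 h4 h4
  · rw [← h3, h4] at h1; omega
  · rw [h3, h1]; rfl
  · rw [h4, sub_zero]
  · ring

theorem gaps_jump_left (hξ : IsGaps ξ X) {j : ℤ} (h1 : ξ.1 (j : ZMod K) = 1)
    (h2 : ξ.1 ((j - 1 : ℤ) : ZMod K) ≤ 0) :
    IsGaps (ξ.jump (j : ZMod K) ((j - 1 : ℤ) : ZMod K) h2) (moveLabel K j (-1) X) := by
  rw [hξ.moveLabel_iff]
  intro i
  have e : i + 1 = (j : ZMod K) ↔ i = ((j - 1 : ℤ) : ZMod K) := by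
    push_cast; exact eq_sub_iff_add_eq.symm
  simp only [Gam.jump, e]
  split_ifs with h3 h4 h4
  · rw [← h4, h3] at h2; omega
  · rw [h3, h1]; rfl
  · rw [h4]; ring
  · ring

variable [NeZero K]

/-- Change of variables from occupied sites to labels modulo `K`, which turns the FEP generator into
a sum over the sites of the SWT. -/
theorem sum_occ (hX : IsEnum η X) (F : ZMod N → ℝ) :
    ∑ x, η.occ x * F x = ∑ j : ZMod K, F (X (j.cast : ℤ) : ZMod N) := by
  simp only [Conf.occ, ite_mul, one_mul, zero_mul]
  rw [← Finset.sum_filter]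
  symm
  refine Finset.sum_nbij (fun j : ZMod K => (X (j.cast : ℤ) : ZMod N)) (fun j _ => ?_) ?_ ?_
    (fun _ _ => rfl)
  · simpa using hX.occ_apply _
  · intro i _ j _ h
    have h1 := (intCast_eq_iff_dvd _ _).2 ((hX.cast_eq_iff _ _).1 h)
    simpa using h1
  · intro x hx
    obtain ⟨x, rfl⟩ := ZMod.intCast_surjective x
    obtain ⟨k, rfl⟩ := (hX.mem_iff x).1 (by simpa using hx)
    refine ⟨(k : ZMod K), Finset.mem_coe.2 (Finset.mem_univ _), ?_⟩
    exact (hX.cast_eq_iff _ _).2 ((intCast_eq_iff_dvd _ _).1 (by simp))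

/-- The generators of the two processes agree on functions which agree at all reachable
configurations. -/
theorem fepGen_eq_swtGen (hX : IsEnum η X) (hξ : IsGaps ξ X) (G : Conf N K → ℝ) (H : Gam K → ℝ)
    (h0 : G η = H ξ)
    (hmove : ∀ (j e : ℤ) (b : Conf N K) (ξ' : Gam K), (e = 1 ∨ e = -1) → 2 ≤ K → b ≠ η →
      IsEnum b (moveLabel K j e X) → IsGaps ξ' (moveLabel K j e X) → G b = H ξ') :
    fepGen N K G η = swtGen K H ξ := by
  -- With a single site no jump is possible, since its value would have to be both `1` and `≤ 0`.
  have hK : ∀ {k l : ZMod K}, ξ.1 k = 1 → ξ.1 l ≤ 0 → 2 ≤ K := by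
    intro k l h1 h2
    by_contra h
    obtain rfl : K = 1 := by have := NeZero.one_le (n := K); omega
    rw [Subsingleton.elim k l] at h1
    omega
  have hne : ∀ (j : ℤ) b, b.1 (X j : ZMod N) = false → b ≠ η := by
    intro j b hb h
    rw [h, hX.occ_apply] at hb
    exact Bool.noConfusion hb
  have hright : ∀ j : ℤ, η.occ ((X j : ZMod N) - 1) * (1 - η.occ ((X j : ZMod N) + 1)) *
      (G (η.exch (X j : ZMod N)) - G η) =
      if h : ξ.1 ((j - 1 : ℤ) : ZMod K) = 1 ∧ ξ.1 (((j - 1 : ℤ) : ZMod K) + ((1 : ℤ) : ZMod K)) ≤ 0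
      then H (ξ.jump ((j - 1 : ℤ) : ZMod K) (((j - 1 : ℤ) : ZMod K) + ((1 : ℤ) : ZMod K)) h.2) - H ξ
      else 0 := by
    intro j
    have hj : (((j - 1 : ℤ) : ZMod K) + ((1 : ℤ) : ZMod K)) = (j : ZMod K) := by push_cast; ring
    simp only [hj]
    have e1 := hX.gap_pred_eq_one_iff hξ j
    have e2 := hX.gap_nonpos_iff hξ j
    have c1 : ((X j - 1 : ℤ) : ZMod N) = (X j : ZMod N) - 1 := by push_cast; ring
    have c2 : ((X j + 1 : ℤ) : ZMod N) = (X j : ZMod N) + 1 := by push_cast; ring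
    split_ifs with h
    · have a1 := e1.1 h.1
      have a2 := e2.1 h.2
      have hb := hX.exch_right a2
      have hbne : η.exch (X j : ZMod N) ≠ η := hne j _ (by
        change η.1 (Equiv.swap _ _ _) = false
        rw [Equiv.swap_apply_left, ← c2, a2])
      rw [hmove j 1 _ _ (Or.inl rfl) (hK h.1 h.2) hbne hb (gaps_jump_right hξ h.1 h.2), h0]
      rw [c1] at a1
      rw [c2] at a2
      simp [Conf.occ, a1, a2]
    · rw [e1, e2, c1, c2] at h
      simp only [Conf.occ]
      split_ifs with h1 h2 h2
      · simp
      · exact absurd ⟨h1, Bool.eq_false_iff.2 h2⟩ h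
      · simp
      · simp
  have hleft : ∀ j : ℤ, (1 - η.occ ((X j : ZMod N) - 1)) * η.occ ((X j : ZMod N) + 1) *
      (G (η.exch ((X j : ZMod N) - 1)) - G η) =
      if h : ξ.1 (j : ZMod K) = 1 ∧ ξ.1 ((j : ZMod K) + ((-1 : ℤ) : ZMod K)) ≤ 0
      then H (ξ.jump (j : ZMod K) ((j : ZMod K) + ((-1 : ℤ) : ZMod K)) h.2) - H ξ
      else 0 := by
    intro j
    have hj : (j : ZMod K) + ((-1 : ℤ) : ZMod K) = ((j - 1 : ℤ) : ZMod K) := by push_cast; ring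
    simp only [hj]
    have e1 := hX.gap_eq_one_iff hξ j
    have e2 := hX.gap_pred_nonpos_iff hξ j
    have c1 : ((X j - 1 : ℤ) : ZMod N) = (X j : ZMod N) - 1 := by push_cast; ring
    have c2 : ((X j + 1 : ℤ) : ZMod N) = (X j : ZMod N) + 1 := by push_cast; ring
    split_ifs with h
    · have a1 := e1.1 h.1
      have a2 := e2.1 h.2
      have hb := hX.exch_left a2
      rw [c1] at hb
      have hbne : η.exch ((X j : ZMod N) - 1) ≠ η := hne j _ (by
        change η.1 (Equiv.swap _ _ _) = false
        rw [sub_add_cancel, Equiv.swap_apply_right, ← c1, a2])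
      rw [hmove j (-1) _ _ (Or.inr rfl) (hK h.1 h.2) hbne hb (gaps_jump_left hξ h.1 h.2), h0]
      rw [c2] at a1
      rw [c1] at a2
      simp [Conf.occ, a1, a2]
    · rw [e1, e2, c1, c2] at h
      simp only [Conf.occ]
      split_ifs with h1 h2 h2
      · simp
      · simp
      · exact absurd ⟨h2, Bool.eq_false_iff.2 h1⟩ h
      · simp
  -- The sum over bonds becomes a sum over moving particles: right moves are indexed by the left end
  -- of the bond, left moves by the right end, whence the translation by one.
  have hfep : fepGen N K G η =
      ∑ x, η.occ x * (η.occ (x - 1) * (1 - η.occ (x + 1)) * (G (η.exch x) - G η)) +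
      ∑ x, η.occ x * ((1 - η.occ (x - 1)) * η.occ (x + 1) * (G (η.exch (x - 1)) - G η)) := by
    rw [← Equiv.sum_comp (Equiv.addRight (1 : ZMod N)) fun x =>
      η.occ x * ((1 - η.occ (x - 1)) * η.occ (x + 1) * (G (η.exch (x - 1)) - G η)),
      ← Finset.sum_add_distrib, fepGen]
    refine Finset.sum_congr rfl fun x _ => ?_
    have h2 : x + 1 + 1 = x + 2 := by ring
    simp only [Equiv.coe_addRight, add_sub_cancel_right, h2, fepRate]
    ring
  rw [hfep, hX.sum_occ, hX.sum_occ, swtGen]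
  simp only [Finset.sum_pair (show (1 : ℤ) ≠ -1 by norm_num)]
  rw [Finset.sum_add_distrib]
  congr 1
  -- When particle `j` moves right, the unit leaves the gap behind it, so the corresponding SWT jump
  -- starts from `j - 1`.
  · conv_rhs => rw [← Equiv.sum_comp (Equiv.subRight (1 : ZMod K))]
    refine Finset.sum_congr rfl fun j _ => ?_
    have hj : Equiv.subRight (1 : ZMod K) j = (((j.cast : ℤ) - 1 : ℤ) : ZMod K) := by
      push_cast
      rfl
    rw [hright, hj]
  · refine Finset.sum_congr rfl fun j _ => ?_
    rw [hleft]
    simp only [ZMod.intCast_zmod_cast]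

end IsEnum

end FepSwt

/-! ### Canonical labels and their shift at a jump -/

namespace FepSwt

theorem moveLabel_shift (K : ℕ) (j e c : ℤ) (X : ℤ → ℤ) (k : ℤ) :
    moveLabel K j e (fun k => X (k + c)) k = moveLabel K (j + c) e X (k + c) := by
  simp only [moveLabel, add_sub_add_right_eq_sub]

variable {N K : ℕ} [NeZero N]

theorem Conf.le (η : Conf N K) : K ≤ N := by
  have h := Finset.card_le_univ (Finset.univ.filter fun x => η.1 x = true)
  rwa [η.2, ZMod.card] at h

/-- For `K = N` only the full configuration exists. With `K ≥ 2`, an actual jump therefore forces `N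
≥ 3`, as `moveLabel_unique` requires. -/
theorem Conf.lt_of_ne {η η' : Conf N K} (h : η ≠ η') : K < N := by
  refine lt_of_le_of_ne η.le fun hKN => h ?_
  have hfull : ∀ (ζ : Conf N K) x, ζ.1 x = true := by
    intro ζ x
    have h1 : (Finset.univ.filter fun x => ζ.1 x = true) = Finset.univ := by
      rw [← Finset.card_eq_iff_eq_univ, ζ.2, ZMod.card, hKN]
    have h2 := Finset.mem_univ x
    rw [← h1] at h2
    exact (Finset.mem_filter.1 h2).2
  exact Conf.ext fun x => by rw [hfull η, hfull η']

variable [NeZero K]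

/-- Two enumerations of the same configuration obtained from `X` by moving one label agree. -/
theorem IsEnum.moveLabel_unique {η : Conf N K} {X : ℤ → ℤ} {j e j' e' : ℤ} (he : e = 1 ∨ e = -1)
    (he' : e' = 1 ∨ e' = -1) (hN : 3 ≤ N) (h : IsEnum η (moveLabel K j e X))
    (h' : IsEnum η (moveLabel K j' e' X)) : moveLabel K j' e' X = moveLabel K j e X := by
  obtain ⟨m, hm⟩ := h.unique h'
  have h1 := h.sum_shift m
  have h2 := IsEnum.sum_moveLabel (K := K) X j e
  have h3 := IsEnum.sum_moveLabel (K := K) X j' e'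
  simp only [hm] at h3
  rw [Finset.sum_sub_distrib] at h1 h2 h3
  have h4 : e' - e = m * N := by linarith
  have h5 : (3 : ℤ) ≤ N := by exact_mod_cast hN
  -- `e' - e` lies in `[-2, 2]` and is a multiple of `N ≥ 3`.
  have h6 : m = 0 := by
    rcases lt_trichotomy m 0 with h | h | h
    · nlinarith [he, he', show e' - e ≥ -2 by omega]
    · exact h
    · nlinarith [he, he', show e' - e ≤ 2 by omega]
  funext k
  rw [hm, h6, add_zero]

/-- One move changes the sum of positions over a period by `±1`, which is not a multiple of `N ≥ 2`.
Hence no tagged particle moves while the configuration stays the same. -/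
theorem IsEnum.not_moveLabel {η : Conf N K} {X : ℤ → ℤ} {j e : ℤ} (he : e = 1 ∨ e = -1)
    (hN : 2 ≤ N) (h : IsEnum η X) (h' : IsEnum η (moveLabel K j e X)) : False := by
  obtain ⟨m, hm⟩ := h.unique h'
  have h1 := h.sum_shift m
  have h2 := IsEnum.sum_moveLabel (K := K) X j e
  simp only [hm] at h2
  have h3 : (2 : ℤ) ≤ N := by exact_mod_cast hN
  rw [h1] at h2
  rcases lt_trichotomy m 0 with h | h | h
  · nlinarith [he, show e ≥ -1 by omega]
  · rw [h] at h2; omega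
  · nlinarith [he, show e ≤ 1 by omega]

/-- The enumeration of the particles of `η` with particle `1` the first one at or to the right of
the origin. -/
noncomputable def enum (η : Conf N K) : ℤ → ℤ := (exists_isEnum η).choose

theorem isEnum_enum (η : Conf N K) : IsEnum η (enum η) := (exists_isEnum η).choose_spec.1

theorem isFirst_enum (η : Conf N K) : IsFirst (enum η) := (exists_isEnum η).choose_spec.2

/-- The gaps of `η`, with the labels shifted by `c`. -/
noncomputable def rotGaps (η : Conf N K) (c : ℤ) : Gam K := ((isEnum_enum η).shift c).gaps

theorem isGaps_rotGaps (η : Conf N K) (c : ℤ) :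
    IsGaps (rotGaps η c) fun k => enum η (k + c) := ((isEnum_enum η).shift c).isGaps

open Classical in
/-- The shift of the canonical labels when the configuration jumps from `a` to `b`: it does not
vanish when a particle crosses the origin. -/
noncomputable def labelShift (a b : Conf N K) : ℤ :=
  if h : a ≠ b ∧ ∃ m j e : ℤ, (e = 1 ∨ e = -1) ∧ ∀ k, enum b (k + m) = moveLabel K j e (enum a) k
    then h.2.choose else 0

theorem labelShift_self (a : Conf N K) : labelShift a a = 0 := by simp [labelShift]

theorem labelShift_spec {a b : Conf N K} (hab : a ≠ b) {j e : ℤ} (he : e = 1 ∨ e = -1)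
    (hb : IsEnum b (moveLabel K j e (enum a))) : ∃ j e : ℤ, (e = 1 ∨ e = -1) ∧
      ∀ k, enum b (k + labelShift a b) = moveLabel K j e (enum a) k := by
  obtain ⟨m, hm⟩ := (isEnum_enum b).unique hb
  have h : a ≠ b ∧ ∃ m j e : ℤ, (e = 1 ∨ e = -1) ∧
      ∀ k, enum b (k + m) = moveLabel K j e (enum a) k :=
    ⟨hab, m, j, e, he, fun k => (hm k).symm⟩
  rw [labelShift, dif_pos h]
  exact h.2.choose_spec

/-- The choice made in `labelShift` is harmless: any single label move leading from `a` to `b`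
yields the same enumeration, by `moveLabel_unique`. -/
theorem moveLabel_enum (hK : 2 ≤ K) {a b : Conf N K} (hab : a ≠ b) {j e c : ℤ}
    (he : e = 1 ∨ e = -1) (hb : IsEnum b (moveLabel K j e fun k => enum a (k + c))) :
    moveLabel K j e (fun k => enum a (k + c)) = fun k => enum b (k + (c + labelShift a b)) := by
  have hN : 3 ≤ N := by have := Conf.lt_of_ne hab; omega
  have hb' : IsEnum b (moveLabel K (j + c) e (enum a)) := by
    have := hb.shift (-c)
    simp only [moveLabel_shift, neg_add_cancel_right] at this
    exact this
  obtain ⟨j', e', he', h⟩ := labelShift_spec hab he hb'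
  have hb'' : IsEnum b (moveLabel K j' e' (enum a)) := by
    have := (isEnum_enum b).shift (labelShift a b)
    simp only [h] at this
    exact this
  have huniq := hb''.moveLabel_unique he' he hN hb'
  funext k
  rw [moveLabel_shift, huniq, ← h, add_assoc]

/-! ### The mapping -/

/-- The statical mapping. -/
noncomputable def statMap (η : Conf N K) : Gam K := rotGaps η 0

theorem isGaps_statMap (η : Conf N K) : IsGaps (statMap η) (enum η) := by
  have h := isGaps_rotGaps η 0
  simp only [add_zero] at h
  exact h

/-- The net number of label shifts along a path. -/
noncomputable abbrev labelCount (ω : CadlagPath (Conf N K)) : ℝ≥0 → ℤ :=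
  CadlagPath.jumpSum labelShift ω

/-- The dynamical mapping. -/
noncomputable def dynMap : CadlagPath (Conf N K) → CadlagPath (Gam K) :=
  CadlagPath.extend labelShift labelShift_self rotGaps

theorem dynMap_apply (ω : CadlagPath (Conf N K)) (t : ℝ≥0) :
    dynMap ω t = rotGaps (ω t) (labelCount ω t) := rfl

theorem dynMap_zero (ω : CadlagPath (Conf N K)) : dynMap ω 0 = statMap (ω 0) := by
  rw [dynMap_apply, labelCount, CadlagPath.jumpSum_zero, statMap]

theorem isTagging_enum {ω : CadlagPath (Conf N K)} (hω : IsExclusionPath ω) :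
    IsTagging ω fun t k => enum (ω t) (k + labelCount ω t) where
  isEnum t := (isEnum_enum _).shift _
  initial := by
    simp only [labelCount, CadlagPath.jumpSum_zero, add_zero]
    exact isFirst_enum _
  right_cont t := by
    filter_upwards [ω.right_cont t, CadlagPath.eventually_jumpSum_right labelShift labelShift_self
      ω t] with s h1 h2
    simp only [labelCount, h1, h2]
  jump t ht := by
    obtain ⟨u, hu, hut⟩ :=
      CadlagPath.eventually_jumpSum_left labelShift labelShift_self ω ht
    have ha := ω.leftLim_spec t
    have hjump := hω t ht _ ha
    revert hut hjump ha
    generalize ω.leftLim t = a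
    intro hut ha hjump
    refine ⟨fun k => enum a (k + u), ?_, ?_⟩
    · filter_upwards [ha, hu] with s h1 h2
      simp only [labelCount, h1, h2]
    · simp only [labelCount, hut]
      by_cases hat : ω t = a
      · left
        rw [hat, labelShift_self, add_zero]
      · right
        obtain ⟨x, hx⟩ := hjump.resolve_left hat
        obtain ⟨j, e, he, hj⟩ := (isEnum_enum a).exists_moveLabel_exch (hx ▸ hat)
        -- The move selected by `labelShift` is used rather than the one of the exchange, so
        -- uniqueness is not needed here; the label `j' - u` undoes the shift accumulated before the
        -- jump.
        rw [← hx] at hj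
        obtain ⟨j', e', he', h⟩ := labelShift_spec (Ne.symm hat) he hj
        refine ⟨j' - u, e', he', fun k => ?_⟩
        rw [← add_assoc, h, moveLabel, show k + u - j' = k - (j' - u) by ring]

/-- Induction along the half line: the labels agree at time `0` by the convention at the origin, and
each jump preserves the agreement by `moveLabel_enum`, or by `not_moveLabel` if the configuration
does not change. -/
theorem IsTagging.eq_enum (hK : 2 ≤ K) {ω : CadlagPath (Conf N K)} {X : ℝ≥0 → ℤ → ℤ}
    (hX : IsTagging ω X) (t : ℝ≥0) : X t = fun k => enum (ω t) (k + labelCount ω t) := by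
  have hN : 2 ≤ N := hK.trans (ω 0).le
  induction t using nnreal_induction with
  | h0 =>
    simp only [labelCount, CadlagPath.jumpSum_zero, add_zero]
    exact (hX.isEnum 0).unique_first (isEnum_enum _) hX.initial (isFirst_enum _)
  | hr t ih =>
    filter_upwards [ω.right_cont t, CadlagPath.eventually_jumpSum_right labelShift labelShift_self
      ω t, hX.right_cont t] with s h1 h2 h3
    simp only [labelCount, h1, h2, h3, ih]
  | hl t ht ih =>
    obtain ⟨u, hu, hut⟩ :=
      CadlagPath.eventually_jumpSum_left labelShift labelShift_self ω ht
    have ha := ω.leftLim_spec t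
    revert hut ha
    generalize ω.leftLim t = a
    intro hut ha
    obtain ⟨Y, hY, hjump⟩ := hX.jump t ht
    have hYa : Y = fun k => enum a (k + u) := by
      have := CadlagPath.nhdsLT_neBot ht
      obtain ⟨s, h1, h2, h3, h4⟩ := (hu.and (ha.and (hY.and self_mem_nhdsWithin))).exists
      rw [← h3, ih s h4]
      simp only [labelCount, h1, h2]
    have hYenum : IsEnum a Y := hYa ▸ (isEnum_enum a).shift u
    simp only [labelCount, hut]
    have hXt := hX.isEnum t
    rcases hjump with h | ⟨j, e, he, h⟩
    · rw [h] at hXt ⊢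
      rw [hXt.conf_eq hYenum, labelShift_self, add_zero, hYa]
    · have h' : X t = moveLabel K j e Y := funext h
      rw [h'] at hXt ⊢
      by_cases hat : a = ω t
      · rw [← hat] at hXt
        exact (hYenum.not_moveLabel he hN hXt).elim
      · rw [hYa] at hXt ⊢
        exact moveLabel_enum hK hat he hXt

theorem IsTagging.isGaps {ω : CadlagPath (Conf N K)} {X : ℝ≥0 → ℤ → ℤ}
    (hX : IsTagging ω X) (t : ℝ≥0) : IsGaps (dynMap ω t) (X t) := by
  rcases Nat.lt_or_ge K 2 with hK | hK
  -- For `K = 1` periodicity makes the only gap equal to `2 - N` in every enumeration, so uniqueness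
  -- of the labels is not needed.
  · obtain rfl : K = 1 := by have := NeZero.one_le (n := K); omega
    intro k
    have h1 := (hX.isEnum t).periodic k
    have h2 := ((isEnum_enum (ω t)).shift (labelCount ω t)).periodic k
    rw [dynMap_apply, isGaps_rotGaps]
    rw [Nat.cast_one] at h1 h2
    linarith
  · rw [hX.eq_enum hK t, dynMap_apply]
    exact isGaps_rotGaps _ _

/-! ### From the FEP to the SWT -/

/-- The intertwining relation for the forward direction: a FEP move updates the pair (configuration,
shift) so that its gaps undergo the matching SWT jump. -/
theorem fepGen_rotGaps (a : Conf N K) (c : ℤ) (f : Gam K → ℝ) :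
    fepGen N K (fun b => f (rotGaps b (c + labelShift a b))) a = swtGen K f (rotGaps a c) := by
  refine ((isEnum_enum a).shift c).fepGen_eq_swtGen (isGaps_rotGaps a c) _ _ ?_ ?_
  · simp only [labelShift_self, add_zero]
  · intro j e b ξ' he hK hba hb hξ'
    rw [moveLabel_enum hK hba.symm he hb] at hξ'
    rw [hξ'.eq (isGaps_rotGaps b _)]

omit [NeZero K] in
theorem Conf.occ_eq (η : Conf N K) (x : ZMod N) : η.occ x = 0 ∨ η.occ x = 1 := by
  unfold Conf.occ
  split_ifs <;> simp

omit [NeZero K] in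
theorem fepRate_nonneg (η : Conf N K) (x : ZMod N) : 0 ≤ fepRate η x := by
  unfold fepRate
  rcases η.occ_eq (x - 1) with h1 | h1 <;> rcases η.occ_eq x with h2 | h2 <;>
    rcases η.occ_eq (x + 1) with h3 | h3 <;> rcases η.occ_eq (x + 2) with h4 | h4 <;>
    rw [h1, h2, h3, h4] <;> norm_num

omit [NeZero K] in
theorem fepRate_le (η : Conf N K) (x : ZMod N) : fepRate η x ≤ 1 := by
  unfold fepRate
  rcases η.occ_eq (x - 1) with h1 | h1 <;> rcases η.occ_eq x with h2 | h2 <;>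
    rcases η.occ_eq (x + 1) with h3 | h3 <;> rcases η.occ_eq (x + 2) with h4 | h4 <;>
    rw [h1, h2, h3, h4] <;> norm_num

omit [NeZero K] in
theorem isBoundedOp_fepGen : IsBoundedOp (fepGen N K) (2 * N) := by
  intro f C hf η
  have h : ∀ x ∈ (Finset.univ : Finset (ZMod N)), |fepRate η x * (f (η.exch x) - f η)| ≤ C + C := by
    intro x _
    rw [abs_mul, abs_of_nonneg (fepRate_nonneg η x)]
    exact (mul_le_of_le_one_left (abs_nonneg _) (fepRate_le η x)).trans
      ((abs_sub _ _).trans (add_le_add (hf _) (hf _)))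
  refine (Finset.abs_sum_le_sum_abs _ _).trans ((Finset.sum_le_card_nsmul _ _ _ h).trans_eq ?_)
  rw [Finset.card_univ, ZMod.card, nsmul_eq_mul]
  ring

theorem isBoundedOp_swtGen : IsBoundedOp (swtGen K) (4 * K) := by
  intro f C hf ξ
  have hC : 0 ≤ C := (abs_nonneg _).trans (hf ξ)
  have h : ∀ k ∈ (Finset.univ : Finset (ZMod K)), |∑ z ∈ ({1, -1} : Finset ℤ),
      if h : ξ.1 k = 1 ∧ ξ.1 (k + (z : ZMod K)) ≤ 0
        then f (ξ.jump k (k + (z : ZMod K)) h.2) - f ξ else 0| ≤ 4 * C := by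
    intro k _
    have h2 : ∀ z ∈ ({1, -1} : Finset ℤ), |if h : ξ.1 k = 1 ∧ ξ.1 (k + (z : ZMod K)) ≤ 0
        then f (ξ.jump k (k + (z : ZMod K)) h.2) - f ξ else 0| ≤ 2 * C := by
      intro z _
      split_ifs
      · exact ((abs_sub _ _).trans (add_le_add (hf _) (hf _))).trans_eq (two_mul C).symm
      · rw [abs_zero]; positivity
    refine (Finset.abs_sum_le_sum_abs _ _).trans ((Finset.sum_le_card_nsmul _ _ _ h2).trans_eq ?_)
    rw [Finset.card_pair (by norm_num), nsmul_eq_mul]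
    push_cast; ring
  refine (Finset.abs_sum_le_sum_abs _ _).trans ((Finset.sum_le_card_nsmul _ _ _ h).trans_eq ?_)
  rw [Finset.card_univ, ZMod.card, nsmul_eq_mul]
  ring

omit [NeZero K] in
theorem Conf.finite : Finite (Conf N K) := by unfold Conf; infer_instance

instance : Countable (Conf N K) := by
  have := Conf.finite (N := N) (K := K)
  infer_instance

instance : Countable (Gam K) := by unfold Gam; infer_instance

instance : MeasurableSpace (Conf N K) := ⊤

instance : DiscreteMeasurableSpace (Conf N K) := ⟨fun _ => trivial⟩

instance : MeasurableSpace (Gam K) := ⊤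

instance : DiscreteMeasurableSpace (Gam K) := ⟨fun _ => trivial⟩

theorem measurable_dynMap : Measurable (dynMap (N := N) (K := K)) :=
  CadlagPath.measurable_extend _ _ _

theorem isMarkovLaw_map_dynMap {η : Conf N K} {μ : Measure (CadlagPath (Conf N K))}
    (hμ : IsMarkovLaw (fepGen N K) η μ) : IsMarkovLaw (swtGen K) (statMap η) (μ.map dynMap) :=
  CadlagPath.isMarkovLaw_map_extend isBoundedOp_fepGen hμ labelShift labelShift_self rotGaps
    isBoundedOp_swtGen rfl (fun _ _ => True) (Eventually.of_forall fun _ _ => trivial)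
    fun x u _ f => fepGen_rotGaps x u f

open Classical in
/-- Counts the jumps which are not allowed by the FEP. -/
noncomputable def forbidden (a b : Conf N K) : ℕ :=
  if b = a ∨ ∃ x, 0 < fepRate a x ∧ b = a.exch x then 0 else 1

omit [NeZero K] in
theorem forbidden_self (a : Conf N K) : forbidden a a = 0 := by simp [forbidden]

omit [NeZero K] in
-- The number of forbidden jumps is an additive functional which the generator never increases. The
-- indicator that it is nonzero thus has constant mean, equal to its initial value `0`.
theorem ae_isFepPath {η : Conf N K} {μ : Measure (CadlagPath (Conf N K))}
    (hμ : IsMarkovLaw (fepGen N K) η μ) : ∀ᵐ ω ∂μ, IsFepPath ω := by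
  have := hμ.isProb
  let F : Conf N K → ℕ → ℝ := fun _ u => if u = 0 then 0 else 1
  have hF : ∀ x u, |F x u| ≤ 1 := fun x u => by
    simp only [F]
    split_ifs <;> simp
  have hF0 : ∀ x u, 0 ≤ F x u := fun x u => by
    simp only [F]
    split_ifs <;> simp
  have hgen : ∀ (a : Conf N K) (u : ℕ), fepGen N K (fun y => F y (u + forbidden a y)) a = 0 := by
    intro a u
    refine Finset.sum_eq_zero fun x _ => ?_
    rcases eq_or_lt_of_le (fepRate_nonneg a x) with h | h
    · rw [← h, zero_mul]
    · have h1 : forbidden a (a.exch x) = 0 := if_pos (Or.inr ⟨x, h, rfl⟩)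
      simp only [forbidden_self, h1, F, sub_self, mul_zero]
  have hzero : ∀ t : ℝ≥0, ∀ᵐ ω ∂μ, CadlagPath.jumpSum forbidden ω t = 0 := by
    intro t
    have h := CadlagPath.setIntegral_jumpSum isBoundedOp_fepGen hμ forbidden forbidden_self hF
      (zero_le (a := t)) (@MeasurableSet.univ _ (canonicalFiltration (Conf N K) 0))
    simp only [hgen, CadlagPath.jumpSum_zero, intervalIntegral.integral_zero, sub_zero,
      Measure.restrict_univ] at h
    have hm : Measurable fun ω : CadlagPath (Conf N K) =>
        F (ω t) (CadlagPath.jumpSum forbidden ω t) :=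
      (Measurable.of_discrete (f := fun u : ℕ => (if u = 0 then 0 else 1 : ℝ))).comp
        ((CadlagPath.measurable_jumpSum forbidden forbidden_self le_rfl).mono
          ((canonicalFiltration (Conf N K)).le t) le_rfl)
    have hint : Integrable (fun ω : CadlagPath (Conf N K) =>
        F (ω t) (CadlagPath.jumpSum forbidden ω t)) μ :=
      Integrable.of_bound hm.aestronglyMeasurable 1 (Eventually.of_forall fun ω => hF (ω t) _)
    have h2 : ∫ ω, F (ω t) (CadlagPath.jumpSum forbidden ω t) ∂μ = 0 := by simpa [F] using h
    filter_upwards [(integral_eq_zero_iff_of_nonneg (fun ω => hF0 (ω t) _) hint).1 h2] with ω hω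
    by_contra hne
    simp [F, hne] at hω
  -- The counter is nondecreasing in time, so integer times control all times.
  have hall : ∀ᵐ ω ∂μ, ∀ n : ℕ, CadlagPath.jumpSum forbidden ω n = 0 :=
    ae_all_iff.2 fun n => hzero n
  filter_upwards [hall] with ω hω t ht a ha
  have hω' : ∀ t, CadlagPath.jumpSum forbidden ω t = 0 := by
    intro t
    obtain ⟨n, hn⟩ := exists_nat_ge t
    exact Nat.le_zero.1 ((CadlagPath.jumpSum_mono forbidden ω hn).trans_eq (hω n))
  obtain ⟨u, -, hu⟩ := CadlagPath.eventually_jumpSum_left forbidden forbidden_self ω ht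
  rw [hω', ω.leftLim_eq ht ha] at hu
  have h1 : forbidden a (ω t) = 0 := by omega
  by_contra hcon
  simp [forbidden, hcon] at h1

end FepSwt

namespace FepSwt

/-! ### From the SWT back to the FEP -/

theorem CadlagPath.ext {S : Type*} {ω ω' : CadlagPath S} (h : ∀ t, ω t = ω' t) : ω = ω' := by
  cases ω; cases ω'
  congr 1
  exact funext h

variable {N K : ℕ} [NeZero N]

open Classical in
/-- The displacement of the particle of label `0` when the gaps jump from `ξ` to `ξ'`. -/
noncomputable def zeroMove (ξ ξ' : Gam K) : ℤ :=
  if ξ = ξ' then 0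
  else if ∀ i : ZMod K, ξ'.1 i = ξ.1 i + (if i = 0 then 1 else 0) - if i + 1 = 0 then 1 else 0 then 1
  else if ∀ i : ZMod K, ξ'.1 i = ξ.1 i + (if i = 0 then -1 else 0) - if i + 1 = 0 then -1 else 0
    then -1
  else 0

theorem zeroMove_self (ξ : Gam K) : zeroMove ξ ξ = 0 := if_pos rfl

theorem natCast_ne_zero_of_lt {n : ℕ} (h0 : 0 < n) (h : n < K) : (n : ZMod K) ≠ 0 := by
  rw [Ne, ZMod.natCast_eq_zero_iff]
  exact Nat.not_dvd_of_pos_of_lt h0 h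

/-- A move of label `j` by `e` adds `e` to gap `j` and `-e` to gap `j - 1`. Evaluation at `0` and
`-1` shows that a dipole with `j ≠ 0` could match one at `0` only if `j = 1 = -1`, that is `2 = 0`.
For `K = 2` this does happen: moving label `0` by `1` and label `1` by `-1` change the gaps
identically. -/
theorem dipole_injective (hK : 3 ≤ K) {j : ZMod K} {e s : ℤ}
    (hs : s = 1 ∨ s = -1)
    (h : ∀ i : ZMod K, (if i = j then e else 0) - (if i + 1 = j then e else 0) =
      (if i = 0 then s else 0) - if i + 1 = 0 then s else 0) : j = 0 ∧ e = s := by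
  have h1 : (1 : ZMod K) ≠ 0 := by exact_mod_cast natCast_ne_zero_of_lt one_pos (by omega : 1 < K)
  have h2 : (2 : ZMod K) ≠ 0 := by exact_mod_cast natCast_ne_zero_of_lt two_pos (by omega : 2 < K)
  have e0 := h 0
  have e1 := h (-1)
  have hm : ¬ (-1 : ZMod K) = 0 := neg_ne_zero.2 h1
  simp only [zero_add, h1, hm, neg_add_cancel, if_true, if_false] at e0 e1
  by_cases hj : (0 : ZMod K) = j
  · refine ⟨hj.symm, ?_⟩
    have h3 : ¬ (1 : ZMod K) = j := fun h => h1 (h.trans hj.symm)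
    simp only [hj, h3, if_true, if_false] at e0
    omega
  · exfalso
    simp only [hj, if_false] at e0 e1
    have hj1 : (1 : ZMod K) = j := by
      by_contra hne
      simp only [hne, if_false] at e0
      omega
    have hj2 : (-1 : ZMod K) = j := by
      by_contra hne
      simp only [hne, if_false] at e1
      omega
    apply h2
    have h3 : (1 : ZMod K) = -1 := hj1.trans hj2.symm
    calc (2 : ZMod K) = 1 + 1 := by norm_num
      _ = -1 + 1 := by rw [← h3]
      _ = 0 := neg_add_cancel 1

theorem zeroMove_eq (hK : 3 ≤ K) {ξ ξ' : Gam K} {X : ℤ → ℤ} (hξ : IsGaps ξ X) {j e : ℤ}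
    (he : e = 1 ∨ e = -1) (hξ' : IsGaps ξ' (moveLabel K j e X)) :
    moveLabel K j e X 0 = X 0 + zeroMove ξ ξ' := by
  have h := (hξ.moveLabel_iff j e).1 hξ'
  have hcond : ∀ s : ℤ, (s = 1 ∨ s = -1) → (∀ i : ZMod K, ξ'.1 i =
      ξ.1 i + (if i = 0 then s else 0) - if i + 1 = 0 then s else 0) → (j : ZMod K) = 0 ∧ e = s :=
    fun s hs hc => dipole_injective hK hs fun i => by
      have h1 := hc i
      have h2 := h i
      linarith
  have hne : ξ ≠ ξ' := by
    rintro rfl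
    have h1 := h (j : ZMod K)
    have h2 : ¬ (j : ZMod K) + 1 = j := fun h' =>
      natCast_ne_zero_of_lt one_pos (by omega : 1 < K) (by simpa using h')
    simp only [h2, if_true, if_false] at h1
    omega
  have hdvd : (K : ℤ) ∣ 0 - j ↔ (j : ZMod K) = 0 := by
    rw [zero_sub, dvd_neg, ZMod.intCast_zmod_eq_zero_iff_dvd]
  rw [zeroMove, if_neg hne, moveLabel]
  by_cases hj : (j : ZMod K) = 0
  · rw [if_pos (hdvd.2 hj)]
    rw [hj] at h
    rcases he with rfl | rfl
    · rw [if_pos h]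
    · rw [if_neg fun hc => by have := (hcond 1 (Or.inl rfl) hc).2; omega, if_pos h]
  · rw [if_neg (fun hd => hj (hdvd.1 hd)), if_neg fun hc => hj (hcond 1 (Or.inl rfl) hc).1,
      if_neg fun hc => hj (hcond (-1) (Or.inr rfl) hc).1, add_zero]

theorem eq_of_isGaps {ξ : Gam K} {X X' : ℤ → ℤ} (h : IsGaps ξ X) (h' : IsGaps ξ X')
    (h0 : X 0 = X' 0) : X = X' := by
  have hstep : ∀ k, X (k + 1) - X k = X' (k + 1) - X' k := fun k => by
    have h1 := h k
    have h2 := h' k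
    omega
  funext k
  induction k using Int.induction_on with
  | zero => exact h0
  | succ i ih => have := hstep i; omega
  | pred i ih =>
    have := hstep (-(i : ℤ) - 1)
    rw [sub_add_cancel] at this
    omega

/-- The pair formed by the gaps `ξ` and the position `p` of the particle of label `0` comes from an
exclusion configuration. -/
def IsConsistent (N : ℕ) [NeZero N] (ξ : Gam K) (p : ℤ) (η : Conf N K) : Prop :=
  ∃ X, IsEnum η X ∧ X 0 = p ∧ IsGaps ξ X

open Classical in
/-- The exclusion configuration with gaps `ξ` and with a particle of label `0` at `p`
(and `η₀` if there is none). -/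
noncomputable def rebuild (η₀ : Conf N K) (ξ : Gam K) (p : ℤ) : Conf N K :=
  if h : ∃ η, IsConsistent N ξ p η then h.choose else η₀

/-- The gaps and the position of label `0` determine the enumeration, hence the configuration, so
the choice in `rebuild` is forced. -/
theorem IsConsistent.rebuild_eq {ξ : Gam K} {p : ℤ} {η : Conf N K} (h : IsConsistent N ξ p η)
    (η₀ : Conf N K) : rebuild η₀ ξ p = η := by
  have hex : ∃ η, IsConsistent N ξ p η := ⟨η, h⟩
  rw [rebuild, dif_pos hex]
  obtain ⟨X, hX, hX0, hXξ⟩ := h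
  obtain ⟨X', hX', hX0', hXξ'⟩ := hex.choose_spec
  rw [eq_of_isGaps hXξ hXξ' (hX0.trans hX0'.symm)] at hX
  exact hX'.conf_eq hX

variable [NeZero K]

/-- The intertwining relation for the inverse map. It is asserted for consistent pairs only, since
otherwise `rebuild` may return the default `η₀`. -/
theorem swtGen_rebuild (hK : 3 ≤ K) {ξ : Gam K} {p : ℤ} {η : Conf N K} (h : IsConsistent N ξ p η)
    (η₀ : Conf N K) (f : Conf N K → ℝ) :
    swtGen K (fun ξ' => f (rebuild η₀ ξ' (p + zeroMove ξ ξ'))) ξ =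
      fepGen N K f (rebuild η₀ ξ p) := by
  rw [h.rebuild_eq η₀]
  obtain ⟨X, hX, hX0, hξ⟩ := id h
  refine (hX.fepGen_eq_swtGen hξ _ _ ?_ ?_).symm
  · simp only [zeroMove_self, add_zero, h.rebuild_eq η₀]
  · intro j e b ξ' he _ _ hb hξ'
    have hc : IsConsistent N ξ' (p + zeroMove ξ ξ') b :=
      ⟨_, hb, by rw [zeroMove_eq hK hξ he hξ', hX0], hξ'⟩
    rw [hc.rebuild_eq η₀]

/-- The motion of label `0` is a functional of the gap trajectory alone, which makes the dynamical
mapping invertible from a given starting configuration. -/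
theorem IsTagging.position_zero (hK : 3 ≤ K) {ω : CadlagPath (Conf N K)} {X : ℝ≥0 → ℤ → ℤ}
    (hX : IsTagging ω X) (t : ℝ≥0) :
    X t 0 = enum (ω 0) 0 + CadlagPath.jumpSum zeroMove (dynMap ω) t := by
  induction t using nnreal_induction with
  | h0 =>
    rw [CadlagPath.jumpSum_zero, add_zero,
      (hX.isEnum 0).unique_first (isEnum_enum _) hX.initial (isFirst_enum _)]
  | hr t ih =>
    filter_upwards [CadlagPath.eventually_jumpSum_right zeroMove zeroMove_self (dynMap ω) t,
      hX.right_cont t] with s h1 h2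
    rw [h1, h2, ih]
  | hl t ht ih =>
    obtain ⟨u, hu, hut⟩ :=
      CadlagPath.eventually_jumpSum_left zeroMove zeroMove_self (dynMap ω) ht
    have ha := (dynMap ω).leftLim_spec t
    revert hut ha
    generalize (dynMap ω).leftLim t = ξ
    intro hut ha
    obtain ⟨Y, hY, hjump⟩ := hX.jump t ht
    have hYξ : IsGaps ξ Y ∧ Y 0 = enum (ω 0) 0 + u := by
      have := CadlagPath.nhdsLT_neBot ht
      obtain ⟨s, h1, h2, h3, h4⟩ := (hu.and (ha.and (hY.and self_mem_nhdsWithin))).exists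
      rw [← h3, ← h2, ← h1]
      exact ⟨hX.isGaps s, ih s h4⟩
    rw [hut, ← add_assoc, ← hYξ.2]
    have hXt := hX.isGaps t
    rcases hjump with h | ⟨j, e, he, h⟩
    · rw [h] at hXt ⊢
      rw [hXt.eq hYξ.1, zeroMove_self, add_zero]
    · have h' : X t = moveLabel K j e Y := funext h
      rw [h'] at hXt ⊢
      exact zeroMove_eq hK hYξ.1 he hXt

/-- The inverse of the dynamical mapping, on trajectories started from `η₀`. -/
noncomputable def undoMap (η₀ : Conf N K) : CadlagPath (Gam K) → CadlagPath (Conf N K) :=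
  CadlagPath.extend zeroMove zeroMove_self fun ξ u => rebuild η₀ ξ (enum η₀ 0 + u)

theorem isConsistent_dynMap (hK : 3 ≤ K) {ω : CadlagPath (Conf N K)} (hω : IsExclusionPath ω)
    (t : ℝ≥0) : IsConsistent N (dynMap ω t)
      (enum (ω 0) 0 + CadlagPath.jumpSum zeroMove (dynMap ω) t) (ω t) :=
  have hX := isTagging_enum hω
  ⟨_, hX.isEnum t, hX.position_zero hK t, hX.isGaps t⟩

theorem undoMap_dynMap (hK : 3 ≤ K) {ω : CadlagPath (Conf N K)} (hω : IsExclusionPath ω) :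
    undoMap (ω 0) (dynMap ω) = ω :=
  CadlagPath.ext fun t => (isConsistent_dynMap hK hω t).rebuild_eq _

/-- Since `undoMap` inverts `dynMap` almost surely, `μ` is the image of an SWT law under a map of
the form `extend`, and the general transfer result applies. -/
theorem isMarkovLaw_of_map_dynMap (hK : 3 ≤ K) {η : Conf N K}
    {μ : Measure (CadlagPath (Conf N K))} (h0 : ∀ᵐ ω ∂μ, ω 0 = η)
    (hex : ∀ᵐ ω ∂μ, IsExclusionPath ω)
    (hμ : IsMarkovLaw (swtGen K) (statMap η) (μ.map dynMap)) : IsMarkovLaw (fepGen N K) η μ := by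
  have hmeas : Measurable (undoMap η) := CadlagPath.measurable_extend _ _ _
  have hback : (μ.map dynMap).map (undoMap η) = μ := by
    rw [Measure.map_map hmeas measurable_dynMap]
    conv_rhs => rw [← Measure.map_id (μ := μ)]
    refine Measure.map_congr ?_
    filter_upwards [h0, hex] with ω h1 h2
    rw [Function.comp_apply, ← h1, undoMap_dynMap hK h2, id]
  rw [← hback]
  refine CadlagPath.isMarkovLaw_map_extend isBoundedOp_swtGen hμ zeroMove zeroMove_self _
    isBoundedOp_fepGen ?_ (fun ξ u => ∃ η', IsConsistent N ξ (enum η 0 + u) η') ?_ ?_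
  · refine IsConsistent.rebuild_eq ⟨enum η, isEnum_enum η, ?_, isGaps_statMap η⟩ η
    rw [add_zero]
  -- Consistency at all times holds almost surely under the image law because the original
  -- trajectory supplies the configurations; measurability of this event is needed to pass to the
  -- image.
  · refine (ae_map_iff measurable_dynMap.aemeasurable
      (CadlagPath.measurableSet_forall zeroMove zeroMove_self
        fun ξ u => ∃ η', IsConsistent N ξ (enum η 0 + u) η')).2 ?_
    filter_upwards [h0, hex] with ω h1 h2 t
    have := isConsistent_dynMap hK h2 t
    rw [h1] at this
    exact ⟨_, this⟩
  · rintro ξ u ⟨η', h⟩ f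
    simp only [← add_assoc]
    exact swtGen_rebuild hK h η f

/-! ### Degenerate cases with vanishing rates -/

omit [NeZero K] in
-- With no allowed jump a FEP trajectory is constant and the generator is zero, so every martingale
-- in the problem vanishes almost surely.
theorem isMarkovLaw_of_fepRate_eq_zero (hrate : ∀ (η : Conf N K) x, ¬ 0 < fepRate η x)
    {η : Conf N K} {μ : Measure (CadlagPath (Conf N K))} [hprob : IsProbabilityMeasure μ]
    (h0 : ∀ᵐ ω ∂μ, ω 0 = η) (hfep : ∀ᵐ ω ∂μ, IsFepPath ω) : IsMarkovLaw (fepGen N K) η μ := by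
  have hgen : ∀ (f : Conf N K → ℝ) (a : Conf N K), fepGen N K f a = 0 := fun f a =>
    Finset.sum_eq_zero fun x _ => by
      rw [le_antisymm (not_lt.1 (hrate a x)) (fepRate_nonneg a x), zero_mul]
  have hconst : ∀ ω : CadlagPath (Conf N K), IsFepPath ω → ∀ t, ω t = ω 0 := by
    intro ω hω t
    refine ω.eq_of_no_jumps zero_le fun s hs hsJ => ?_
    rcases hω s hs.1 _ (ω.leftLim_spec s) with h | ⟨x, hx, -⟩
    · exact hsJ.2 h
    · exact hrate _ x hx
  refine ⟨hprob, h0, fun f ⟨C, hC⟩ => ?_⟩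
  have hz : ∀ t : ℝ≥0, CadlagPath.increment (fepGen N K) f 0 t =ᵐ[μ] 0 := by
    intro t
    filter_upwards [hfep] with ω hω
    simp only [CadlagPath.increment, hgen, hconst ω hω t, intervalIntegral.integral_zero, sub_self,
      Pi.zero_apply]
  refine ⟨fun t => (CadlagPath.measurable_increment isBoundedOp_fepGen hC
    zero_le).stronglyMeasurable, fun s t _ => ?_⟩
  refine (condExp_congr_ae (hz t)).trans ?_
  rw [condExp_zero]
  exact (hz s).symm

/-- A move needs two distinct particles, which excludes `K = 1`. If `N ≤ 2`, then `y + 2 = y` and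
each rate contains a factor `η_y * (1 - η_y) = 0`. -/
theorem fepRate_eq_zero (h : K = 1 ∨ N ≤ 2) (η : Conf N K) (x : ZMod N) : ¬ 0 < fepRate η x := by
  have key : ∀ y : ZMod N, η.occ y * η.occ (y + 1) * (1 - η.occ (y + 2)) = 0 ∧
      (1 - η.occ y) * η.occ (y + 1) * η.occ (y + 2) = 0 := by
    intro y
    rcases h with rfl | hN
    · have hsingle : ∀ a b : ZMod N, η.1 a = true → η.1 b = true → a = b := by
        intro a b ha hb
        have := Finset.card_le_one.1 η.2.le
        exact this a (by simpa using ha) b (by simpa using hb)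
      have h12 : y + 1 + 1 = y + 2 := by ring
      constructor
      · by_cases h1 : η.1 y = true
        · by_cases h2 : η.1 (y + 1) = true
          · have h3 := hsingle _ _ h1 h2
            rw [← h12, ← h3, ← h3]
            simp [Conf.occ, h1]
          · simp [Conf.occ, h2]
        · simp [Conf.occ, h1]
      · by_cases h1 : η.1 (y + 1) = true
        · by_cases h2 : η.1 (y + 2) = true
          · have h3 := hsingle _ _ h1 h2
            have h4 : y = y + 1 := add_right_cancel (b := 1) (by rw [h12]; exact h3)
            rw [← h4] at h1
            simp [Conf.occ, h1]
          · simp [Conf.occ, h2]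
        · simp [Conf.occ, h1]
    · have h2 : y + 2 = y := by
        have hN0 : N ≠ 0 := NeZero.ne N
        have hN' : N = 1 ∨ N = 2 := by omega
        have : ((2 : ℕ) : ZMod N) = 0 := by
          rw [ZMod.natCast_eq_zero_iff]
          rcases hN' with rfl | rfl <;> norm_num
        push_cast at this
        rw [this, add_zero]
      rw [h2]
      rcases η.occ_eq y with h1 | h1 <;> rw [h1] <;> norm_num
  have h1 := (key (x - 1)).1
  have h2 := (key x).2
  rw [sub_add_cancel, show x - 1 + 2 = x + 1 by ring] at h1
  rw [fepRate, h1, h2]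
  norm_num

end FepSwt

theorem theorem2p3 (N K : ℕ) [NeZero N] [NeZero K] (hKN : K ≤ N) :
    ∃ (stat : FepSwt.Conf N K → FepSwt.Gam K)
      (dyn : FepSwt.CadlagPath (FepSwt.Conf N K) → FepSwt.CadlagPath (FepSwt.Gam K)),
      Measurable dyn ∧
      -- the statical mapping is given by the positions of the particles, and is the initial
      -- value of the dynamical mapping
      (∀ (η : FepSwt.Conf N K) (X : ℤ → ℤ), FepSwt.IsEnum η X → FepSwt.IsFirst X →
        ∀ k : ℤ, (stat η).1 (k : ZMod K) = 2 + X k - X (k + 1)) ∧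
      (∀ ω, dyn ω 0 = stat (ω 0)) ∧
      -- the dynamical mapping is given by the positions of the tagged particles
      (∀ ω : FepSwt.CadlagPath (FepSwt.Conf N K), FepSwt.IsExclusionPath ω →
        (∃ X : ℝ≥0 → ℤ → ℤ, FepSwt.IsTagging ω X) ∧
        ∀ X : ℝ≥0 → ℤ → ℤ, FepSwt.IsTagging ω X →
          ∀ (t : ℝ≥0) (k : ℤ), (dyn ω t).1 (k : ZMod K) = 2 + X t k - X t (k + 1)) ∧
      -- the image of a FEP is a SWT
      (∀ (η : FepSwt.Conf N K) (μ : Measure (FepSwt.CadlagPath (FepSwt.Conf N K))),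
        FepSwt.IsMarkovLaw (FepSwt.fepGen N K) η μ →
          (∀ᵐ ω ∂μ, FepSwt.IsFepPath ω) ∧
          FepSwt.IsMarkovLaw (FepSwt.swtGen K) (stat η) (μ.map dyn)) ∧
      -- conversely, a process whose image is a SWT is a FEP
      (∀ (η : FepSwt.Conf N K) (μ : Measure (FepSwt.CadlagPath (FepSwt.Conf N K))),
        IsProbabilityMeasure μ → (∀ᵐ ω ∂μ, ω 0 = η) →
        ((3 ≤ K ∧ ∀ᵐ ω ∂μ, FepSwt.IsExclusionPath ω) ∨
          ((K ≠ 2 ∨ N = 2) ∧ ∀ᵐ ω ∂μ, FepSwt.IsFepPath ω)) →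
        FepSwt.IsMarkovLaw (FepSwt.swtGen K) (stat η) (μ.map dyn) →
          FepSwt.IsMarkovLaw (FepSwt.fepGen N K) η μ) ∧
      -- preservation of the ergodic, frozen and transient components
      (∀ (ω : FepSwt.CadlagPath (FepSwt.Conf N K)) (t : ℝ≥0),
        (ω t ∈ FepSwt.fepErgodic N K ↔ dyn ω t ∈ FepSwt.swtErgodic K) ∧
        (ω t ∈ FepSwt.fepFrozen N K ↔ dyn ω t ∈ FepSwt.swtFrozen K) ∧
        (ω t ∈ FepSwt.fepTransient N K ↔ dyn ω t ∈ FepSwt.swtTransient K)) := by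
  refine ⟨FepSwt.statMap, FepSwt.dynMap, FepSwt.measurable_dynMap, ?_, FepSwt.dynMap_zero, ?_, ?_,
    ?_, ?_⟩
  · intro η X hX hfirst k
    rw [hX.unique_first (FepSwt.isEnum_enum η) hfirst (FepSwt.isFirst_enum η)]
    exact FepSwt.isGaps_statMap η k
  · exact fun ω hω => ⟨⟨_, FepSwt.isTagging_enum hω⟩, fun X hX t => hX.isGaps t⟩
  · exact fun η μ hμ => ⟨FepSwt.ae_isFepPath hμ, FepSwt.isMarkovLaw_map_dynMap hμ⟩
  · intro η μ hprob h0 hpath hμ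
    by_cases hK : 3 ≤ K
    · refine FepSwt.isMarkovLaw_of_map_dynMap hK h0 ?_ hμ
      rcases hpath with ⟨-, hex⟩ | ⟨-, hfep⟩
      · exact hex
      · filter_upwards [hfep] with ω hω t ht a ha
        exact (hω t ht a ha).imp_right fun ⟨x, _, hx⟩ => ⟨x, hx⟩
    -- Here `K ≤ 2`, and `K ≠ 2 ∨ N = 2` leaves only `K = 1` or `N = 2`, where no move is possible.
    · obtain ⟨hcase, hfep⟩ := hpath.resolve_left fun h => hK h.1
      have hK0 : K ≠ 0 := NeZero.ne K
      exact FepSwt.isMarkovLaw_of_fepRate_eq_zero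
        (FepSwt.fepRate_eq_zero (by omega)) h0 hfep
  · intro ω t
    have hX := (FepSwt.isEnum_enum (ω t)).shift (FepSwt.labelCount ω t)
    have hξ : FepSwt.IsGaps (FepSwt.dynMap ω t) _ :=
      FepSwt.isGaps_rotGaps (ω t) (FepSwt.labelCount ω t)
    exact ⟨hX.mem_fepErgodic_iff hξ, hX.mem_fepFrozen_iff hξ, hX.mem_fepTransient_iff hξ⟩
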